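/- Let $F_n$ be the free group on $x_1,\dots,x_n$. A graph over the $n$-rose is a graph whose edges are oriented and labelled by $x_1,\dots,x_n$. For a nontrivial subgroup $H\le F_n$, let $\mathrm{Core}(H)$ be the union of the non-degenerate loops (images of locally injective maps from the circle) in the covering of the $n$-rose corresponding to $H$. For a vertex $v$, let $L(v)\subseteq\{x_1^{\pm1},\dots,x_n^{\pm1}\}$ be the set of letters of the edges leaving $v$ ($x_i\in L(v)$ if an edge labelled $x_i$ starts at $v$, $x_i^{-1}\in L(v)$ if an edge labelled $x_i$ ends at $v$). For a letter $a$ and a set $A$ of letters with $a,a^{-1}\notin A$, the Whitehead automorphism $\varphi=(A,a)$ of $F_n$ sends each $x_j$ to $a^{\epsilon}x_ja^{-\delta}$, where $\epsilon=1$ if $x_j\in A$ and $\epsilon=0$ otherwise, and $\delta=1$ if $x_j^{-1}\in A$ and $\delta=0$ otherwise (in particular $a\mapsto a$). For a graph $G$ over the $n$-rose, the subdivided graph $\mathrm{Sub}_\varphi(G)$ is obtained by replacing each edge of $G$, labelled $x_j$, by the edge-path reading the unreduced word $a^{\epsilon}x_ja^{-\delta}$. **Theorem.** Let $H\le F_n$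 be a nontrivial finitely generated subgroup and let $\varphi=(A,a)$ be a Whitehead automorphism. Suppose that at each vertex $v$ of $\mathrm{Core}(H)$ exactly one of the following holds: (i) $L(v)\cap A=\emptyset$; (ii) $L(v)\subseteq A$; (iii) $a\in L(v)$ and $L(v)\subseteq A\cup\{a\}$. Let $q:\mathrm{Core}(H)\to Q$ be the quotient map that collapses to a point, for each vertex in case (iii), the unique $a$-edge going out of it. Then: 1. There is an isomorphism of graphs $\theta:Q\to\mathrm{Core}(\varphi(H))$ that preserves labels and orientations of edges. 2. Let $r_1:\mathrm{Core}(H)\to \mathrm{Sub}_\varphi(\mathrm{Core}(H))$ send each edge to the edge-path subdividing it. Maximal sequences of Stallings foldings starting from $\mathrm{Sub}_\varphi(\mathrm{Core}(H))$ exist. For each of them, let $r_2:\mathrm{Sub}_\varphi(\mathrm{Core}(H))\to F$ be the resulting quotient map onto the folded graph. Then there is a retraction $r_3:F\to\mathrm{Core}(F)$ which collapses each edge with a valence-$1$ endpoint to its other endpoint, and $\mathrm{Core}(F)$ is isomorphic, as a labelled oriented graph, to $\mathrm{Core}(\varphi(H))$. Moreover, for every such retraction $r_3$ and every such isomorphism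 $\iota:\mathrm{Core}(F)\to\mathrm{Core}(\varphi(H))$, the isomorphism $\theta$ in 1 can be chosen so that the map $r=\iota\circ r_3\circ r_2\circ r_1:\mathrm{Core}(H)\to\mathrm{Core}(\varphi(H))$ has the following properties: $r(v)=(\theta\circ q)(v)$ for each vertex $v$ of $\mathrm{Core}(H)$; for each edge $e$ of $\mathrm{Core}(H)$ the map $r|_e$ is a weakly monotone reparametrization of $(\theta\circ q)|_e$; and $r$ and $\theta\circ q$ are homotopic relative to the $0$-skeleton of $\mathrm{Core}(H)$. -/

import Mathlib

open scoped unitInterval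

noncomputable section

/-! ## Letters and Whitehead automorphisms -/

/-- The letters `x₁, …, xₙ, x₁⁻¹, …, xₙ⁻¹`: `(i, true)` is `xᵢ` and `(i, false)` is `xᵢ⁻¹`. -/
abbrev Letter (n : ℕ) : Type := Fin n × Bool

/-- The inverse letter. -/
def Letter.inv {n : ℕ} (l : Letter n) : Letter n := (l.1, !l.2)

/-- The element of the free group represented by a letter. -/
def Letter.toFree {n : ℕ} (l : Letter n) : FreeGroup (Fin n) := FreeGroup.mk [l]

/-- The data `(A, a)` of a Whitehead automorphism of the free group of rank `n`: an acting letter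
`a` and a set `A` of letters containing neither `a` nor its inverse. -/
structure WhiteheadAut (n : ℕ) where
  a : Letter n
  A : Set (Letter n)
  a_notMem : a ∉ A
  inv_notMem : a.inv ∉ A

namespace WhiteheadAut

variable {n : ℕ}

open Classical in
/-- The image of the generator `xⱼ`: multiply by `a` on the left if `xⱼ ∈ A`, and by `a⁻¹` on the
right if `xⱼ⁻¹ ∈ A`. -/
def genImage (φ : WhiteheadAut n) (j : Fin n) : FreeGroup (Fin n) :=
  (if (j, true) ∈ φ.A then φ.a.toFree else 1) * FreeGroup.of j *
    (if (j, false) ∈ φ.A then φ.a.toFree⁻¹ else 1)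

/-- The endomorphism of the free group defined by `(A, a)`. -/
def toHom (φ : WhiteheadAut n) : FreeGroup (Fin n) →* FreeGroup (Fin n) :=
  FreeGroup.lift φ.genImage

/-- The pair `(A, a⁻¹)`, which defines the inverse automorphism. -/
def symm (φ : WhiteheadAut n) : WhiteheadAut n where
  a := φ.a.inv
  A := φ.A
  a_notMem := φ.inv_notMem
  inv_notMem := by simpa [Letter.inv] using φ.a_notMem

theorem symm_symm (φ : WhiteheadAut n) : φ.symm.symm = φ := by
  cases φ; simp [symm, Letter.inv]

theorem genImage_a (φ : WhiteheadAut n) : φ.genImage φ.a.1 = FreeGroup.of φ.a.1 := by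
  rcases φ with ⟨⟨i, b⟩, A, h1, h2⟩
  have h1' : (i, true) ∉ A := by cases b <;> simp_all [Letter.inv]
  have h2' : (i, false) ∉ A := by cases b <;> simp_all [Letter.inv]
  simp [genImage, h1', h2']

theorem toHom_a (φ : WhiteheadAut n) : φ.toHom φ.a.toFree = φ.a.toFree := by
  have h := φ.genImage_a
  have e : φ.a.toFree = if φ.a.2 then FreeGroup.of φ.a.1 else (FreeGroup.of φ.a.1)⁻¹ := by
    rcases φ with ⟨⟨i, b⟩, A, h1, h2⟩
    cases b <;> simp [Letter.toFree, FreeGroup.of, FreeGroup.inv_mk, FreeGroup.invRev]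
  rw [e]
  split_ifs <;> simp [toHom, h]

theorem toFree_inv (l : Letter n) : l.inv.toFree = l.toFree⁻¹ := by
  simp [Letter.toFree, Letter.inv, FreeGroup.inv_mk, FreeGroup.invRev]

theorem toHom_symm_comp (φ : WhiteheadAut n) : φ.symm.toHom.comp φ.toHom = MonoidHom.id _ := by
  refine FreeGroup.ext_hom _ _ fun j => ?_
  have h : φ.symm.toHom φ.a.toFree = φ.a.toFree := by
    have := φ.symm.toHom_a
    change φ.symm.toHom φ.a.inv.toFree = φ.a.inv.toFree at this
    rwa [toFree_inv, map_inv, inv_inj] at this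
  have hj : φ.symm.toHom (FreeGroup.of j) = φ.symm.genImage j := by simp [toHom]
  have hj' : φ.toHom (FreeGroup.of j) = φ.genImage j := by simp [toHom]
  rw [MonoidHom.comp_apply, hj']
  have ha : φ.symm.a.toFree = φ.a.toFree⁻¹ := toFree_inv _
  have hA : φ.symm.A = φ.A := rfl
  unfold genImage at *
  rw [hA, ha] at hj
  simp only [map_mul, hj]
  by_cases h1 : (j, true) ∈ φ.A <;> by_cases h2 : (j, false) ∈ φ.A <;>
    simp [h1, h2, h, mul_assoc]

/-- The Whitehead automorphism `(A, a)`. -/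
def toMulEquiv (φ : WhiteheadAut n) : FreeGroup (Fin n) ≃* FreeGroup (Fin n) :=
  MonoidHom.toMulEquiv φ.toHom φ.symm.toHom φ.toHom_symm_comp
    (by simpa [symm_symm] using φ.symm.toHom_symm_comp)

end WhiteheadAut

/-! ## Labelled graphs -/

/-- A graph over the `n`-rose (loops and multiple edges allowed): each edge carries an orientation
and a label in `{x₁, …, xₙ}`. -/
structure LGraph (n : ℕ) where
  V : Type
  E : Type
  src : E → V
  tgt : E → V
  lab : E → Fin n

namespace LGraph

variable {n : ℕ}

/-- Oriented edges: `(e, true)` is `e` with its own orientation, `(e, false)` is `e` reversed. -/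
abbrev Dart (G : LGraph n) : Type := G.E × Bool

/-- The vertex at which an oriented edge starts. -/
def init (G : LGraph n) (d : G.Dart) : G.V := if d.2 then G.src d.1 else G.tgt d.1

/-- The vertex at which an oriented edge ends. -/
def term (G : LGraph n) (d : G.Dart) : G.V := if d.2 then G.tgt d.1 else G.src d.1

/-- The letter read along an oriented edge. -/
def letter (G : LGraph n) (d : G.Dart) : Letter n := (G.lab d.1, d.2)

/-- The set `L(v)` of letters at the vertex `v`. -/
def letters (G : LGraph n) (v : G.V) : Set (Letter n) :=
  {l | ∃ d : G.Dart, G.init d = v ∧ G.letter d = l}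

/-- Label-preserving maps: vertices go to vertices, and edges to edges with the same label and
orientation. -/
structure Hom (G G' : LGraph n) where
  onV : G.V → G'.V
  onE : G.E → G'.E
  src_onE : ∀ e, G'.src (onE e) = onV (G.src e)
  tgt_onE : ∀ e, G'.tgt (onE e) = onV (G.tgt e)
  lab_onE : ∀ e, G'.lab (onE e) = G.lab e

/-- The identity map. -/
def Hom.id (G : LGraph n) : Hom G G := ⟨_root_.id, _root_.id, fun _ => rfl, fun _ => rfl, fun _ => rfl⟩

/-- Composition of label-preserving maps. -/
def Hom.comp {G G' G'' : LGraph n} (g : Hom G' G'') (f : Hom G G') : Hom G G'' where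
  onV := g.onV ∘ f.onV
  onE := g.onE ∘ f.onE
  src_onE e := by simp [g.src_onE, f.src_onE]
  tgt_onE e := by simp [g.tgt_onE, f.tgt_onE]
  lab_onE e := by simp [g.lab_onE, f.lab_onE]

/-- Isomorphisms of labelled graphs. -/
structure Iso (G G' : LGraph n) extends Hom G G' where
  bijective_onV : Function.Bijective onV
  bijective_onE : Function.Bijective onE

/-! ### Core graphs -/

/-- `c` runs periodically, with period `m > 0`, along a closed edge-path that never backtracks
(also not cyclically): the combinatorial form of a locally injective map from the circle. -/
def IsReducedCycle (G : LGraph n) (m : ℕ) (c : ℕ → G.Dart) : Prop :=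
  0 < m ∧ (∀ i, c (i + m) = c i) ∧ (∀ i, G.term (c i) = G.init (c (i + 1))) ∧
    ∀ i, c (i + 1) ≠ ((c i).1, !(c i).2)

/-- The vertex `v` lies on a non-degenerate loop. -/
def VInCore (G : LGraph n) (v : G.V) : Prop :=
  ∃ m c, G.IsReducedCycle m c ∧ ∃ i, G.init (c i) = v

/-- The edge `e` lies on a non-degenerate loop. -/
def EInCore (G : LGraph n) (e : G.E) : Prop :=
  ∃ m c, G.IsReducedCycle m c ∧ ∃ i, (c i).1 = e

theorem EInCore.ends {G : LGraph n} {e : G.E} (h : G.EInCore e) :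
    G.VInCore (G.src e) ∧ G.VInCore (G.tgt e) := by
  obtain ⟨m, c, hc, i, rfl⟩ := h
  have h1 : G.VInCore (G.init (c i)) := ⟨m, c, hc, i, rfl⟩
  have h2 : G.VInCore (G.term (c i)) := ⟨m, c, hc, i + 1, (hc.2.2.1 i).symm⟩
  unfold init at h1
  unfold term at h2
  cases h : (c i).2 <;> simp_all

/-- The core graph: the union of all non-degenerate loops. -/
def core (G : LGraph n) : LGraph n where
  V := {v // G.VInCore v}
  E := {e // G.EInCore e}
  src e := ⟨G.src e.1, e.2.ends.1⟩
  tgt e := ⟨G.tgt e.1, e.2.ends.2⟩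
  lab e := G.lab e.1

/-- The inclusion of the core graph. -/
def coreIncl (G : LGraph n) : Hom G.core G :=
  ⟨Subtype.val, Subtype.val, fun _ => rfl, fun _ => rfl, fun _ => rfl⟩

/-- The covering of the `n`-rose corresponding to the subgroup `H`: its vertices are the cosets
`Hg`, and for each `j` there is an edge labelled `xⱼ` from `Hg` to `H(gxⱼ)`. -/
def cover (H : Subgroup (FreeGroup (Fin n))) : LGraph n where
  V := Quotient (QuotientGroup.rightRel H)
  E := Quotient (QuotientGroup.rightRel H) × Fin n
  src e := e.1
  tgt e := Quotient.map' (s₂ := QuotientGroup.rightRel H) (fun g => g * FreeGroup.of e.2)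
    (fun g g' h => by
      rw [QuotientGroup.rightRel_apply] at h ⊢
      simpa [mul_assoc] using h) e.1
  lab e := e.2

/-- The core graph of a subgroup. -/
def coreOf (H : Subgroup (FreeGroup (Fin n))) : LGraph n := (cover H).core

/-! ### Stallings' folding -/

/-- `f : G → G'` is a single folding operation: there are two distinct edges with a common
endpoint, the same label and the same orientation there, and `f` is the quotient map which
identifies these two edges, and their other endpoints, and nothing else. -/
def IsFold {G G' : LGraph n} (f : Hom G G') : Prop :=
  ∃ d₁ d₂ : G.Dart, d₁.1 ≠ d₂.1 ∧ G.init d₁ = G.init d₂ ∧ G.letter d₁ = G.letter d₂ ∧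
    Function.Surjective f.onV ∧ Function.Surjective f.onE ∧
    (∀ u v, f.onV u = f.onV v ↔
      u = v ∨ (u = G.term d₁ ∧ v = G.term d₂) ∨ (u = G.term d₂ ∧ v = G.term d₁)) ∧
    (∀ e e', f.onE e = f.onE e' ↔
      e = e' ∨ (e = d₁.1 ∧ e' = d₂.1) ∨ (e = d₂.1 ∧ e' = d₁.1))

/-- `f` is the composition of a finite (possibly empty) sequence of folding operations. -/
inductive IsFoldSeq : ∀ {G G' : LGraph n}, Hom G G' → Prop
  | refl (G : LGraph n) : IsFoldSeq (Hom.id G)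
  | tail {G G' G'' : LGraph n} {f : Hom G G'} {g : Hom G' G''} :
      IsFoldSeq f → IsFold g → IsFoldSeq (g.comp f)

/-- No folding operation is possible. -/
def IsFolded (G : LGraph n) : Prop :=
  ∀ d₁ d₂ : G.Dart, G.init d₁ = G.init d₂ → G.letter d₁ = G.letter d₂ → d₁.1 = d₂.1

/-- `f : G → G'` is the quotient map given by a maximal sequence of folding operations, so that
`G'` is the folded graph of `G`. -/
def IsMaximalFolding {G G' : LGraph n} (f : Hom G G') : Prop := IsFoldSeq f ∧ G'.IsFolded

/-! ### Collapsing edges -/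

/-- The graph obtained from `G` by collapsing each edge in `C` to a point. -/
def collapse (G : LGraph n) (C : Set G.E) : LGraph n where
  V := Quot fun u v : G.V => ∃ e ∈ C, G.src e = u ∧ G.tgt e = v
  E := {e // e ∉ C}
  src e := Quot.mk _ (G.src e.1)
  tgt e := Quot.mk _ (G.tgt e.1)
  lab e := G.lab e.1

/-! ### Geometric realization -/

/-- Disjoint union of a point for each vertex and a unit interval for each edge. -/
def Pieces (G : LGraph n) : Type := G.V ⊕ (Σ _ : G.E, I)

/-- The vertices form a discrete space. -/
instance (G : LGraph n) : TopologicalSpace G.Pieces :=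
  letI : TopologicalSpace G.V := ⊥
  inferInstanceAs (TopologicalSpace (G.V ⊕ (Σ _ : G.E, I)))

/-- The endpoints of the intervals are glued to the vertices. -/
inductive Glue (G : LGraph n) : G.Pieces → G.Pieces → Prop
  | src (e : G.E) : Glue G (Sum.inr ⟨e, 0⟩) (Sum.inl (G.src e))
  | tgt (e : G.E) : Glue G (Sum.inr ⟨e, 1⟩) (Sum.inl (G.tgt e))

/-- The topological graph `|G|`. -/
def Realization (G : LGraph n) : Type := Quot G.Glue

instance (G : LGraph n) : TopologicalSpace G.Realization :=
  inferInstanceAs (TopologicalSpace (Quot G.Glue))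

/-- A vertex as a point of `|G|`. -/
def vert (G : LGraph n) (v : G.V) : G.Realization := Quot.mk _ (Sum.inl v)

/-- The path in `|G|` running along the edge `e`. -/
def edgePath (G : LGraph n) (e : G.E) : Path (G.vert (G.src e)) (G.vert (G.tgt e)) where
  toFun t := Quot.mk _ (Sum.inr ⟨e, t⟩)
  continuous_toFun := by
    let _ : TopologicalSpace G.V := ⊥
    have h : Continuous fun t : I => (Sum.inr ⟨e, t⟩ : G.V ⊕ (Σ _ : G.E, I)) :=
      continuous_inr.comp continuous_sigmaMk
    exact continuous_quot_mk.comp h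
  source' := Quot.sound (Glue.src e)
  target' := Quot.sound (Glue.tgt e)

/-- The path in `|G|` running along an oriented edge. -/
def dartPath (G : LGraph n) : ∀ d : G.Dart, Path (G.vert (G.init d)) (G.vert (G.term d))
  | (e, true) => G.edgePath e
  | (e, false) => (G.edgePath e).symm

/-- The continuous map on `|G|` with prescribed images of the vertices and of the edges. -/
def lift (G : LGraph n) {Y : Type} [TopologicalSpace Y] (fV : G.V → Y)
    (fE : ∀ e, Path (fV (G.src e)) (fV (G.tgt e))) : C(G.Realization, Y) where
  toFun := Quot.lift (fun p : G.Pieces => Sum.elim fV (fun s => fE s.1 s.2) p) (by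
    rintro _ _ (e | e)
    · exact (fE e).source
    · exact (fE e).target)
  continuous_toFun := by
    refine continuous_quot_lift _ ?_
    let _ : TopologicalSpace G.V := ⊥
    have : DiscreteTopology G.V := ⟨rfl⟩
    have h : Continuous (Sum.elim fV (fun s : (Σ _ : G.E, I) => fE s.1 s.2)) :=
      continuous_of_discreteTopology.sumElim
        (continuous_sigma fun e => (fE e).continuous)
    exact h

/-- The continuous map induced by a label-preserving map. -/
def Hom.real {G G' : LGraph n} (f : Hom G G') : C(G.Realization, G'.Realization) :=
  G.lift (fun v => G'.vert (f.onV v)) fun e =>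
    (G'.edgePath (f.onE e)).cast (by rw [f.src_onE]) (by rw [f.tgt_onE])

open Classical in
/-- The quotient map `|G| → |G / C|` collapsing each edge in `C` to a point. -/
def collapseMap (G : LGraph n) (C : Set G.E) : C(G.Realization, (G.collapse C).Realization) :=
  G.lift (fun v => (G.collapse C).vert (Quot.mk _ v)) fun e =>
    if h : e ∈ C then
      (Path.refl ((G.collapse C).vert (Quot.mk _ (G.src e)))).cast rfl
        (congrArg _ (Quot.sound ⟨e, h, rfl, rfl⟩).symm)
    else (G.collapse C).edgePath ⟨e, h⟩

/-- `ρ : |G| → |core G|` is a retraction which collapses each edge with a valence-1 endpoint to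
its other endpoint. -/
def IsLeafRetraction (G : LGraph n) (ρ : C(G.Realization, G.core.Realization)) : Prop :=
  (∀ p, ρ (G.coreIncl.real p) = p) ∧
    ∀ d : G.Dart, (∃! d' : G.Dart, G.init d' = G.init d) →
      ∀ t, G.coreIncl.real (ρ (G.dartPath d t)) = G.vert (G.term d)

/-- The path `γ` is a weakly monotone reparametrization of `δ`. -/
def IsMonotoneReparam {Y : Type} (γ δ : I → Y) : Prop :=
  ∃ s : I → I, Continuous s ∧ Monotone s ∧ s 0 = 0 ∧ s 1 = 1 ∧ ∀ t, γ t = δ (s t)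

end LGraph

/-! ## Action of a Whitehead automorphism on graphs -/

namespace WhiteheadAut

open LGraph

variable {n : ℕ}

/-- Case (i) at the vertex `v`: we act on none of the letters at `v`. -/
def CaseI (φ : WhiteheadAut n) (G : LGraph n) (v : G.V) : Prop := G.letters v ∩ φ.A = ∅

/-- Case (ii) at the vertex `v`: we act on all of the letters at `v`. -/
def CaseII (φ : WhiteheadAut n) (G : LGraph n) (v : G.V) : Prop := G.letters v ⊆ φ.A

/-- Case (iii) at the vertex `v`: `a` is a letter at `v`, and we act on all the other letters. -/
def CaseIII (φ : WhiteheadAut n) (G : LGraph n) (v : G.V) : Prop :=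
  φ.a ∈ G.letters v ∧ G.letters v ⊆ φ.A ∪ {φ.a}

/-- The action of `φ` on `H` satisfies the trichotomy: at each vertex of the core graph of `H`
exactly one of the cases (i), (ii), (iii) takes place. -/
def Trichotomy (φ : WhiteheadAut n) (H : Subgroup (FreeGroup (Fin n))) : Prop :=
  ∀ v : (coreOf H).V,
    (φ.CaseI _ v ∧ ¬ φ.CaseII _ v ∧ ¬ φ.CaseIII _ v) ∨
    (¬ φ.CaseI _ v ∧ φ.CaseII _ v ∧ ¬ φ.CaseIII _ v) ∨
    (¬ φ.CaseI _ v ∧ ¬ φ.CaseII _ v ∧ φ.CaseIII _ v)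

/-- The edges `e` that, for some vertex `v` in case (iii), are the `a`-edge going out of `v`.
(If `a` is the inverse of a generator, this is an edge going into `v`, traversed backwards.) -/
def collapsed (φ : WhiteheadAut n) (G : LGraph n) : Set G.E :=
  {e | ∃ d : G.Dart, d.1 = e ∧ G.letter d = φ.a ∧ φ.CaseIII G (G.init d)}

/-- The oriented edges whose letter lies in `A`. Each one gives a new vertex near its starting
point and a new edge, labelled `a`, from its starting point to this new vertex. -/
abbrev ActedDart (φ : WhiteheadAut n) (G : LGraph n) : Type := {d : G.Dart // G.letter d ∈ φ.A}

open Classical in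
/-- The `φ`-subdivided graph. Vertices: the old vertices `Sum.inl v` and the new ones
`Sum.inr d`. Edges: the old edges `Sum.inl e`, now running between the new vertices close to the
ends of `e` (where these exist), and the new edges `Sum.inr d`. A new edge carries the letter `a`
in the direction from the old vertex to the new one. -/
def subd (φ : WhiteheadAut n) (G : LGraph n) : LGraph n where
  V := G.V ⊕ φ.ActedDart G
  E := G.E ⊕ φ.ActedDart G
  src := Sum.elim
    (fun e => if h : G.letter (e, true) ∈ φ.A then Sum.inr ⟨(e, true), h⟩ else Sum.inl (G.src e))
    (fun d => if φ.a.2 then Sum.inl (G.init d.1) else Sum.inr d)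
  tgt := Sum.elim
    (fun e => if h : G.letter (e, false) ∈ φ.A then Sum.inr ⟨(e, false), h⟩ else Sum.inl (G.tgt e))
    (fun d => if φ.a.2 then Sum.inr d else Sum.inl (G.init d.1))
  lab := Sum.elim G.lab (fun _ => φ.a.1)

/-- The path along a new edge, from the old vertex to the new vertex. -/
def newPath (φ : WhiteheadAut n) (G : LGraph n) (d : φ.ActedDart G) :
    Path ((φ.subd G).vert (Sum.inl (G.init d.1))) ((φ.subd G).vert (Sum.inr d)) :=
  ((φ.subd G).dartPath (Sum.inr d, φ.a.2)).cast
    (congrArg _ (by cases h : φ.a.2 <;> simp [LGraph.init, subd, h]))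
    (congrArg _ (by cases h : φ.a.2 <;> simp [LGraph.term, subd, h]))

open Classical in
/-- The edge-path in the subdivided graph into which the edge `e` is subdivided. -/
def subdPath (φ : WhiteheadAut n) (G : LGraph n) (e : G.E) :
    Path ((φ.subd G).vert (Sum.inl (G.src e))) ((φ.subd G).vert (Sum.inl (G.tgt e))) :=
  let m := (φ.subd G).edgePath (Sum.inl e)
  if h₁ : G.letter (e, true) ∈ φ.A then
    let p := (φ.newPath G ⟨(e, true), h₁⟩).cast rfl
      (congrArg (φ.subd G).vert (by simp [subd, h₁] : (φ.subd G).src (Sum.inl e) = _))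
    if h₂ : G.letter (e, false) ∈ φ.A then
      (p.trans m).trans ((φ.newPath G ⟨(e, false), h₂⟩).symm.cast
        (congrArg (φ.subd G).vert (by simp [subd, h₂] : (φ.subd G).tgt (Sum.inl e) = _)) rfl)
    else
      (p.trans m).cast rfl
        (congrArg (φ.subd G).vert (by simp [subd, h₂] : (φ.subd G).tgt (Sum.inl e) = _)).symm
  else
    if h₂ : G.letter (e, false) ∈ φ.A then
      (m.trans ((φ.newPath G ⟨(e, false), h₂⟩).symm.cast
        (congrArg (φ.subd G).vert (by simp [subd, h₂] : (φ.subd G).tgt (Sum.inl e) = _)) rfl)).cast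
        (congrArg (φ.subd G).vert (by simp [subd, h₁] : (φ.subd G).src (Sum.inl e) = _)).symm rfl
    else
      m.cast
        (congrArg (φ.subd G).vert (by simp [subd, h₁] : (φ.subd G).src (Sum.inl e) = _)).symm
        (congrArg (φ.subd G).vert (by simp [subd, h₂] : (φ.subd G).tgt (Sum.inl e) = _)).symm

/-- The map `|G| → |subd φ G|` which sends each edge to the edge-path subdividing it. -/
def subdMap (φ : WhiteheadAut n) (G : LGraph n) : C(G.Realization, (φ.subd G).Realization) :=
  G.lift (fun v => (φ.subd G).vert (Sum.inl v)) (φ.subdPath G)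

/-- The subgroup `φ(H)`. -/
def image (φ : WhiteheadAut n) (H : Subgroup (FreeGroup (Fin n))) : Subgroup (FreeGroup (Fin n)) :=
  H.map φ.toMulEquiv.toMonoidHom

/-- The graph obtained from the core graph of `H` by collapsing, at each vertex in case (iii), the
`a`-edge going out of it. -/
def quotientGraph (φ : WhiteheadAut n) (H : Subgroup (FreeGroup (Fin n))) : LGraph n :=
  (coreOf H).collapse (φ.collapsed (coreOf H))

/-- The quotient map from the core graph of `H`. -/
def quotientMap (φ : WhiteheadAut n) (H : Subgroup (FreeGroup (Fin n))) :
    C((coreOf H).Realization, (φ.quotientGraph H).Realization) :=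
  (coreOf H).collapseMap (φ.collapsed (coreOf H))

end WhiteheadAut

end

open scoped unitInterval

noncomputable section

/-! The bijection `Hg ↦ φ(H)φ(g)` of cosets extends to a label-preserving map from the subdivided
core of `H` to the covering of `φ(H)`; a new vertex on an edge leaving `Hg` goes to `φ(H)φ(g)a =
φ(H)φ(ga)`. Every folded graph `F` obtained from the subdivided core embeds in this covering
(`exists_embedding`), because folding already forces together all vertices with equal cosets
(`eq_of_subdCoset_eq`). Moreover `F` reads the normal form of every element stabilising a base
coset, so it contains the core of the covering (`core_subset_range`). Hence `Core(F) ≅ Core(φ(H))`;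
this much holds for every Whitehead automorphism.

The trichotomy describes how `F` differs from its core. Where `φ` acts on some letter at `v`, every
letter at `v` lies in `A` or is `a`, so in `F` the old vertex `v` keeps only one edge, labelled `a`:
it is a leaf, attached to the common image of the new vertices at `v` (`eq_newD_of_init_eq`). In
case (iii) the `a`-edge leaving `v` is folded onto this leaf edge. Sending `v` to the far end of its
leaf edge, or to itself in case (i), identifies exactly the ends of the collapsed edges. These are
pairwise disjoint and not loops, so no valence-one vertex arises from collapsing them, and what
remains is `Core(F)` (`quotientIso`).

After retraction the added pieces `a^{±1}` of each subdivided edge become constant while its middle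
part is traversed as in `Q`, or is constant if the edge is collapsed. This gives the monotone
reparametrization, and interpolating the time changes gives the homotopy. -/

theorem Letter.inv_inv {n : ℕ} (l : Letter n) : l.inv.inv = l := by simp [Letter.inv]

theorem Letter.inv_ne {n : ℕ} (l : Letter n) : l.inv ≠ l := by
  intro h
  have := congrArg Prod.snd h
  simp [Letter.inv] at this

namespace LGraph

variable {n : ℕ} {G G' : LGraph n}

/-! ### Oriented edges -/

/-- The reversed oriented edge. -/
def rev (G : LGraph n) (d : G.Dart) : G.Dart := (d.1, !d.2)

@[simp] theorem rev_rev (d : G.Dart) : G.rev (G.rev d) = d := by simp [rev]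

@[simp] theorem init_rev (d : G.Dart) : G.init (G.rev d) = G.term d := by
  rcases d with ⟨e, _ | _⟩ <;> rfl

@[simp] theorem term_rev (d : G.Dart) : G.term (G.rev d) = G.init d := by
  rcases d with ⟨e, _ | _⟩ <;> rfl

@[simp] theorem letter_rev (d : G.Dart) : G.letter (G.rev d) = (G.letter d).inv := rfl

theorem rev_ne (d : G.Dart) : G.rev d ≠ d := by
  intro h
  have := congrArg Prod.snd h
  simp [rev] at this

theorem rev_injective : Function.Injective G.rev := fun d d' h => by
  rw [← G.rev_rev d, h, rev_rev]

theorem dart_eq_or_eq_rev {d d' : G.Dart} (h : d.1 = d'.1) : d = d' ∨ d = G.rev d' := by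
  rcases d with ⟨e, _ | _⟩ <;> rcases d' with ⟨e', _ | _⟩ <;> simp_all [rev]

theorem IsFolded.dart_eq (hG : G.IsFolded) {d d' : G.Dart} (h : G.init d = G.init d')
    (hl : G.letter d = G.letter d') : d = d' :=
  Prod.ext (hG d d' h hl) (congrArg Prod.snd hl :)

/-- The action of a label-preserving map on oriented edges. -/
def Hom.onD (f : Hom G G') (d : G.Dart) : G'.Dart := (f.onE d.1, d.2)

@[simp] theorem Hom.init_onD (f : Hom G G') (d : G.Dart) : G'.init (f.onD d) = f.onV (G.init d) := by
  rcases d with ⟨e, _ | _⟩ <;> simp [Hom.onD, init, f.src_onE, f.tgt_onE]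

@[simp] theorem Hom.term_onD (f : Hom G G') (d : G.Dart) : G'.term (f.onD d) = f.onV (G.term d) := by
  rcases d with ⟨e, _ | _⟩ <;> simp [Hom.onD, term, f.src_onE, f.tgt_onE]

@[simp] theorem Hom.letter_onD (f : Hom G G') (d : G.Dart) : G'.letter (f.onD d) = G.letter d := by
  simp [Hom.onD, letter, f.lab_onE]

@[simp] theorem Hom.onD_fst (f : Hom G G') (d : G.Dart) : (f.onD d).1 = f.onE d.1 := rfl

theorem Hom.onD_injective {f : Hom G G'} (hf : Function.Injective f.onE) :
    Function.Injective f.onD := fun _ _ h =>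
  Prod.ext (hf (congrArg Prod.fst h)) (congrArg Prod.snd h :)

/-- In a folded graph an edge is determined by its source and its label. -/
theorem Hom.onE_injective_of_folded {f : Hom G G'} (hG : G.IsFolded)
    (hf : Function.Injective f.onV) : Function.Injective f.onE := fun e e' h => by
  have h1 : f.onD (e, true) = f.onD (e', true) := by simp [Hom.onD, h]
  refine hG (e, true) (e', true) (hf ?_) ?_
  · rw [← f.init_onD, ← f.init_onD, h1]
  · rw [← f.letter_onD, ← f.letter_onD, h1]

theorem IsFolded.of_hom {f : Hom G G'} (hG' : G'.IsFolded) (hf : Function.Injective f.onE) :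
    G.IsFolded := fun d d' h hl => hf <| by
  have := hG' (f.onD d) (f.onD d') (by simp [h]) (by simp [hl])
  simpa using this

/-! ### Walks -/

/-- The list `L` of oriented edges is an edge-path from `u` to `v`. -/
def IsWalk (G : LGraph n) : G.V → List G.Dart → G.V → Prop
  | u, [], v => u = v
  | u, d :: L, v => G.init d = u ∧ G.IsWalk (G.term d) L v

/-- There is an edge-path from `u` to `v` along which the word `w` is read. -/
def Reads (G : LGraph n) (u : G.V) (w : List (Letter n)) (v : G.V) : Prop :=
  ∃ L, G.IsWalk u L v ∧ L.map G.letter = w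

theorem reads_nil {u v : G.V} : G.Reads u [] v ↔ u = v := by
  simp [Reads, IsWalk]

theorem reads_cons {u v : G.V} {l : Letter n} {w : List (Letter n)} :
    G.Reads u (l :: w) v ↔ ∃ d, G.init d = u ∧ G.letter d = l ∧ G.Reads (G.term d) w v := by
  constructor
  · rintro ⟨L, hL, h⟩
    obtain ⟨d, L, rfl, hd, h'⟩ := List.map_eq_cons_iff.1 h
    exact ⟨d, hL.1, hd, L, hL.2, h'⟩
  · rintro ⟨d, h1, h2, L, h3, h4⟩
    exact ⟨d :: L, ⟨h1, h3⟩, by simp [h2, h4]⟩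

theorem reads_append {u v : G.V} {w w' : List (Letter n)} :
    G.Reads u (w ++ w') v ↔ ∃ x, G.Reads u w x ∧ G.Reads x w' v := by
  induction w generalizing u with
  | nil => simp [reads_nil]
  | cons l w ih =>
    simp only [List.cons_append, reads_cons, ih]
    grind

theorem reads_singleton {d : G.Dart} : G.Reads (G.init d) [G.letter d] (G.term d) :=
  ⟨[d], ⟨rfl, rfl⟩, rfl⟩

theorem Reads.map (f : Hom G G') {u v : G.V} {w : List (Letter n)} (h : G.Reads u w v) :
    G'.Reads (f.onV u) w (f.onV v) := by
  induction w generalizing u with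
  | nil => rw [reads_nil] at *; rw [h]
  | cons l w ih =>
    rw [reads_cons] at *
    obtain ⟨d, rfl, h2, h3⟩ := h
    exact ⟨f.onD d, by simp, by simp [h2], by simpa using ih h3⟩

theorem Reads.inv {u v : G.V} {w : List (Letter n)} (h : G.Reads u w v) :
    G.Reads v (FreeGroup.invRev w) u := by
  induction w generalizing u with
  | nil => rw [reads_nil] at h; simp [reads_nil, h]
  | cons l w ih =>
    rw [reads_cons] at h
    obtain ⟨d, rfl, h2, h3⟩ := h
    rw [FreeGroup.invRev_cons, reads_append]
    refine ⟨_, ih h3, ?_⟩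
    have := reads_singleton (d := G.rev d)
    simpa [h2, FreeGroup.invRev, Letter.inv] using this

/-- In a folded graph a cancelling pair of letters can only be read by going along an edge and
straight back, so deleting the pair keeps the endpoints. -/
theorem IsFolded.reads_step (hG : G.IsFolded) {u v : G.V} {w w' : List (Letter n)}
    (h : FreeGroup.Red.Step w w') (hw : G.Reads u w v) : G.Reads u w' v := by
  obtain ⟨⟩ := h
  simp only [reads_append, reads_cons] at hw ⊢
  obtain ⟨x, h1, d, rfl, h3, d', h4, h5, h6⟩ := hw
  have : d' = G.rev d := hG.dart_eq (by simp [h4]) (by simp [h5, h3, Letter.inv])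
  subst this
  exact ⟨_, h1, by simpa using h6⟩

theorem IsFolded.reads_red (hG : G.IsFolded) {u v : G.V} {w w' : List (Letter n)}
    (h : FreeGroup.Red w w') (hw : G.Reads u w v) : G.Reads u w' v := by
  induction h with
  | refl => exact hw
  | tail _ h ih => exact hG.reads_step h ih

theorem IsFolded.reads_toWord (hG : G.IsFolded) {u v : G.V} {w : List (Letter n)}
    (hw : G.Reads u w v) : G.Reads u (FreeGroup.mk w).toWord v :=
  hG.reads_red FreeGroup.reduce.red hw

theorem IsWalk.head {u v : G.V} {L : List G.Dart} (h : G.IsWalk u L v) {d : G.Dart}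
    (hd : L.head? = some d) : G.init d = u := by
  cases L with
  | nil => simp at hd
  | cons x L => simp at hd; exact hd ▸ h.1

theorem IsWalk.getLast {u v : G.V} {L : List G.Dart} (h : G.IsWalk u L v) {d : G.Dart}
    (hd : L.getLast? = some d) : G.term d = v := by
  induction L generalizing u with
  | nil => simp at hd
  | cons x L ih =>
    cases L with
    | nil => simp at hd; subst hd; exact h.2
    | cons y L => exact ih h.2 (by simpa using hd)

/-- Together with `exists_prev` this supplies the valence condition of `eInCore_of_finite` at all
interior points of a path; only its two ends need a separate argument. -/
theorem IsWalk.exists_next {u v : G.V} {L : List G.Dart} (h : G.IsWalk u L v)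
    (hL : L.IsChain fun d d' => d' ≠ G.rev d) {d : G.Dart} (hd : d ∈ L) :
    (∃ d' ∈ L, G.init d' = G.term d ∧ d' ≠ G.rev d) ∨ L.getLast? = some d := by
  induction L generalizing u with
  | nil => simp at hd
  | cons x L ih =>
    cases L with
    | nil => simp at hd; simp [hd]
    | cons y L =>
      rw [List.isChain_cons_cons] at hL
      rcases List.mem_cons.1 hd with rfl | hd
      · exact .inl ⟨y, by simp, h.2.1, hL.1⟩
      · rcases ih h.2 hL.2 hd with ⟨d', h1, h2⟩ | h1
        · exact .inl ⟨d', List.mem_cons_of_mem _ h1, h2⟩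
        · exact .inr (by simpa using h1)

theorem IsWalk.exists_prev {u v : G.V} {L : List G.Dart} (h : G.IsWalk u L v)
    (hL : L.IsChain fun d d' => d' ≠ G.rev d) {d : G.Dart} (hd : d ∈ L) :
    (∃ d' ∈ L, G.term d' = G.init d ∧ G.rev d' ≠ d) ∨ L.head? = some d := by
  induction L generalizing u with
  | nil => simp at hd
  | cons x L ih =>
    rcases List.mem_cons.1 hd with rfl | hd
    · simp
    · cases L with
      | nil => simp at hd
      | cons y L =>
        rw [List.isChain_cons_cons] at hL
        rcases ih h.2 hL.2 hd with ⟨d', h1, h2⟩ | h1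
        · exact .inl ⟨d', List.mem_cons_of_mem _ h1, h2⟩
        · simp at h1
          subst h1
          exact .inl ⟨x, by simp, h.2.1.symm, hL.1.symm⟩

/-- Backtracking would read a letter followed by its inverse. The converse, `IsFolded.isReduced`,
needs foldedness. -/
theorem isChain_of_isReduced {L : List G.Dart} (h : FreeGroup.IsReduced (L.map G.letter)) :
    L.IsChain fun d d' => d' ≠ G.rev d := by
  rw [FreeGroup.IsReduced, List.isChain_map] at h
  refine h.imp fun d d' h h' => ?_
  subst h'
  simp [letter, rev] at h

/-! ### Criteria for lying in the core -/

theorem IsReducedCycle.prev {m : ℕ} {c : ℕ → G.Dart} (hc : G.IsReducedCycle m c) (i : ℕ) :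
    ∃ j, G.term (c j) = G.init (c i) ∧ c i ≠ G.rev (c j) := by
  obtain ⟨h0, hp, ht, hr⟩ := hc
  obtain ⟨k, rfl⟩ : ∃ k, m = k + 1 := ⟨m - 1, by omega⟩
  -- The predecessor of position `i`, taken one period later so that no subtraction is needed.
  refine ⟨i + k, ?_, ?_⟩
  · rw [ht, add_assoc, hp]
  · have := hr (i + k)
    rwa [add_assoc, hp] at this

/-- The core has no valence-one vertices: besides the dart by which a cycle leaves a vertex there is
the reverse of the one by which it arrived. -/
theorem EInCore.exists_ne {d : G.Dart} (h : G.EInCore d.1) :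
    ∃ d' : G.Dart, G.EInCore d'.1 ∧ G.init d' = G.init d ∧ d' ≠ d := by
  obtain ⟨m, c, hc, i, hi⟩ := h
  rcases dart_eq_or_eq_rev hi with rfl | hi
  · obtain ⟨j, h1, h2⟩ := hc.prev i
    exact ⟨G.rev (c j), ⟨m, c, hc, j, rfl⟩, by simp [h1], h2.symm⟩
  · have : d = G.rev (c i) := by rw [hi, rev_rev]
    subst this
    exact ⟨c (i + 1), ⟨m, c, hc, i + 1, rfl⟩, by simp [hc.2.2.1 i], hc.2.2.2 i⟩

theorem vInCore_iff {v : G.V} : G.VInCore v ↔ ∃ d : G.Dart, G.EInCore d.1 ∧ G.init d = v := by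
  constructor
  · rintro ⟨m, c, hc, i, hi⟩
    exact ⟨c i, ⟨m, c, hc, i, rfl⟩, hi⟩
  · rintro ⟨d, h, rfl⟩
    have := h.ends
    rcases d with ⟨e, _ | _⟩ <;> simp_all [init]

theorem EInCore.init {d : G.Dart} (h : G.EInCore d.1) : G.VInCore (G.init d) :=
  vInCore_iff.2 ⟨d, h, rfl⟩

theorem EInCore.term {d : G.Dart} (h : G.EInCore d.1) : G.VInCore (G.term d) :=
  vInCore_iff.2 ⟨G.rev d, h, by simp⟩

theorem VInCore.exists_ne {v : G.V} (h : G.VInCore v) (d : G.Dart) :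
    ∃ d' : G.Dart, G.EInCore d'.1 ∧ G.init d' = v ∧ d' ≠ d := by
  obtain ⟨d', h1, h2⟩ := vInCore_iff.1 h
  by_cases hd : d' = d
  · subst hd
    obtain ⟨d'', h3, h4, h5⟩ := h1.exists_ne
    exact ⟨d'', h3, h4.trans h2, h5⟩
  · exact ⟨d', h1, h2, hd⟩

theorem not_eInCore_of_existsUnique {d : G.Dart} (h : ∃! d' : G.Dart, G.init d' = G.init d) :
    ¬ G.EInCore d.1 := fun hd => by
  obtain ⟨d', _, h1, h2⟩ := hd.exists_ne
  exact h2 (h.unique h1 rfl)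

theorem not_vInCore_of_existsUnique {v : G.V} (h : ∃! d' : G.Dart, G.init d' = v) :
    ¬ G.VInCore v := fun hd => by
  obtain ⟨d, h1, rfl⟩ := vInCore_iff.1 hd
  exact not_eInCore_of_existsUnique h h1

open Classical in
/-- A finite set of edges without vertices of valence one lies in the core: at each vertex choose
a fixed-point free permutation of the outgoing oriented edges, and follow it. -/
theorem eInCore_of_finite {X : Set G.E} (hX : X.Finite)
    (h : ∀ d : G.Dart, d.1 ∈ X → ∃ d' : G.Dart, d'.1 ∈ X ∧ G.init d' = G.init d ∧ d' ≠ d)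
    {e : G.E} (he : e ∈ X) : G.EInCore e := by
  have hD : {d : G.Dart | d.1 ∈ X}.Finite := by
    have := hX.prod (Set.finite_univ (α := Bool))
    refine this.subset fun d hd => ⟨hd, trivial⟩
  let D (v : G.V) : Finset G.Dart := hD.toFinset.filter fun d => G.init d = v
  have hmem (v : G.V) (d : G.Dart) : d ∈ D v ↔ d.1 ∈ X ∧ G.init d = v := by simp [D]
  -- A cyclic permutation of the darts of `X` at a vertex has no fixed point, since there are at
  -- least two of them.
  choose p hp hsupp using fun v => (D v).countable_toSet.exists_cycleOn
  have hp1 (d : G.Dart) (hd : d.1 ∈ X) : p (G.init d) d ∈ D (G.init d) :=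
    (hp (G.init d)).1.mapsTo ((hmem _ _).2 ⟨hd, rfl⟩)
  have hp2 (d : G.Dart) (hd : d.1 ∈ X) : p (G.init d) d ≠ d := by
    refine (hp (G.init d)).apply_ne ?_ (Finset.mem_coe.2 ((hmem _ _).2 ⟨hd, rfl⟩))
    obtain ⟨d', h1, h2, h3⟩ := h d hd
    exact ⟨d, (hmem _ _).2 ⟨hd, rfl⟩, d', (hmem _ _).2 ⟨h1, h2⟩, h3.symm⟩
  -- Continue past the end of `d` by the dart which the permutation assigns to the reverse of `d`;
  -- having no fixed points means never backtracking.
  let s : {d : G.Dart // d.1 ∈ X} → {d : G.Dart // d.1 ∈ X} := fun d =>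
    ⟨p (G.init (G.rev d.1)) (G.rev d.1), ((hmem _ _).1 (hp1 (G.rev d.1) d.2)).1⟩
  have hs : Function.Injective s := by
    rintro ⟨d, hd⟩ ⟨d', hd'⟩ hdd
    have h1 : p (G.init (G.rev d)) (G.rev d) = p (G.init (G.rev d')) (G.rev d') :=
      congrArg Subtype.val hdd
    have h2 := ((hmem _ _).1 (hp1 (G.rev d) hd)).2
    have h3 := ((hmem _ _).1 (hp1 (G.rev d') hd')).2
    rw [h1, h3] at h2
    rw [h2] at h1
    exact Subtype.ext (rev_injective ((p _).injective h1))
  -- All points of an injective self-map of a finite set are periodic, so the trajectory through `e`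
  -- closes up to a reduced cycle.
  have : Finite {d : G.Dart // d.1 ∈ X} := hD
  obtain ⟨m, hm, hper⟩ := Function.mem_periodicPts.1 (hs.mem_periodicPts ⟨(e, true), he⟩)
  refine ⟨m, fun i => (s^[i] ⟨(e, true), he⟩).1, ⟨hm, fun i => ?_, fun i => ?_, fun i => ?_⟩, 0, rfl⟩
  · beta_reduce
    rw [Function.iterate_add_apply, hper.eq]
  · beta_reduce
    rw [Function.iterate_succ_apply']
    set x := s^[i] ⟨(e, true), he⟩
    rw [((hmem _ _).1 (hp1 (G.rev x.1) x.2)).2, init_rev]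
  · beta_reduce
    rw [Function.iterate_succ_apply']
    exact hp2 (G.rev (s^[i] ⟨(e, true), he⟩).1) (s^[i] ⟨(e, true), he⟩).2

/-- A path without backtracking between vertices of the core stays in the core. -/
theorem IsWalk.eInCore (hG : {e | G.EInCore e}.Finite) {u v : G.V} {L : List G.Dart}
    (h : G.IsWalk u L v) (hL : L.IsChain fun d d' => d' ≠ G.rev d) (hu : G.VInCore u)
    (hv : G.VInCore v) {d : G.Dart} (hd : d ∈ L) : G.EInCore d.1 := by
  -- The core together with the path has no valence-one vertex: inside the path by the absence of
  -- backtracking, at its ends because they are vertices of the core.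
  have hX : ({e | G.EInCore e} ∪ {e | e ∈ L.map Prod.fst}).Finite :=
    hG.union (List.finite_toSet _)
  refine eInCore_of_finite hX ?_ (.inr (List.mem_map_of_mem hd))
  have hmem {x : G.Dart} (hx : x ∈ L) : x.1 ∈ {e | G.EInCore e} ∪ {e | e ∈ L.map Prod.fst} :=
    .inr (List.mem_map_of_mem hx)
  rintro x (hx | hx)
  · obtain ⟨d', h1, h2⟩ := EInCore.exists_ne hx
    exact ⟨d', .inl h1, h2⟩
  · obtain ⟨y, hy, hxy⟩ := List.mem_map.1 hx
    rcases dart_eq_or_eq_rev hxy.symm with rfl | rfl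
    · rcases h.exists_prev hL hy with ⟨d', h1, h2, h3⟩ | h1
      · exact ⟨G.rev d', hmem (x := d') h1, by simpa using h2, h3⟩
      · obtain ⟨d', h2, h3, h4⟩ := hu.exists_ne x
        exact ⟨d', .inl h2, h3.trans (h.head h1).symm, h4⟩
    · rcases h.exists_next hL hy with ⟨d', h1, h2, h3⟩ | h1
      · exact ⟨d', hmem h1, by simpa using h2, h3⟩
      · obtain ⟨d', h2, h3, h4⟩ := hv.exists_ne (G.rev y)
        exact ⟨d', .inl h2, by rw [h3, init_rev, h.getLast h1], h4⟩

/-- A cyclically reduced closed path lies in the core. -/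
theorem IsWalk.eInCore_of_closed {u : G.V} {L : List G.Dart}
    (h : G.IsWalk u L u) (hL : L.IsChain fun d d' => d' ≠ G.rev d)
    (hc : ∀ d ∈ L.getLast?, ∀ d' ∈ L.head?, d' ≠ G.rev d) {d : G.Dart} (hd : d ∈ L) :
    G.EInCore d.1 := by
  refine eInCore_of_finite (X := {e | e ∈ L.map Prod.fst}) (List.finite_toSet _) ?_
    (List.mem_map_of_mem hd)
  have hne : L ≠ [] := by rintro rfl; simp at hd
  have hmem {x : G.Dart} (hx : x ∈ L) : x.1 ∈ {e | e ∈ L.map Prod.fst} :=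
    List.mem_map_of_mem hx
  intro x hx
  obtain ⟨y, hy, hxy⟩ := List.mem_map.1 hx
  have hl := List.getLast?_eq_some_getLast hne
  have hh := List.head?_eq_some_head hne
  rcases dart_eq_or_eq_rev hxy.symm with rfl | rfl
  · rcases h.exists_prev hL hy with ⟨d', h1, h2, h3⟩ | h1
    · exact ⟨G.rev d', hmem (x := d') h1, by simpa using h2, h3⟩
    -- At the base point the closed path continues from its last dart to its first, and `hc`
    -- excludes backtracking there.
    · refine ⟨G.rev (L.getLast hne), hmem (x := L.getLast hne) (List.getLast_mem _), ?_, ?_⟩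
      · rw [init_rev, h.getLast hl, h.head h1]
      · exact (hc _ hl _ h1).symm
  · rcases h.exists_next hL hy with ⟨d', h1, h2, h3⟩ | h1
    · exact ⟨d', hmem h1, by simpa using h2, h3⟩
    · refine ⟨L.head hne, hmem (List.head_mem _), ?_, hc _ h1 _ hh⟩
      rw [init_rev, h.getLast h1, h.head hh]

/-- A vertex of the core. -/
def toCoreV (v : G.V) (h : G.VInCore v) : G.core.V := ⟨v, h⟩

/-- An edge of the core. -/
def toCoreE (e : G.E) (h : G.EInCore e) : G.core.E := ⟨e, h⟩

/-- An oriented edge of the core. -/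
def toCoreD (d : G.Dart) (h : G.EInCore d.1) : G.core.Dart := (toCoreE d.1 h, d.2)

@[simp] theorem coreIncl_toCoreV (v : G.V) (h : G.VInCore v) :
    G.coreIncl.onV (toCoreV v h) = v := rfl

@[simp] theorem coreIncl_toCoreD (d : G.Dart) (h : G.EInCore d.1) :
    G.coreIncl.onD (toCoreD d h) = d := rfl

theorem coreIncl_onV_injective : Function.Injective G.coreIncl.onV := Subtype.val_injective

theorem coreIncl_onE_injective : Function.Injective G.coreIncl.onE := Subtype.val_injective

theorem vInCore_onV (v : G.core.V) : G.VInCore (G.coreIncl.onV v) := v.2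

theorem eInCore_onE (e : G.core.E) : G.EInCore (G.coreIncl.onE e) := e.2

theorem init_toCoreD (d : G.Dart) (h : G.EInCore d.1) :
    G.core.init (toCoreD d h) = toCoreV (G.init d) h.init :=
  coreIncl_onV_injective (by rw [← Hom.init_onD]; simp)

theorem term_toCoreD (d : G.Dart) (h : G.EInCore d.1) :
    G.core.term (toCoreD d h) = toCoreV (G.term d) h.term :=
  coreIncl_onV_injective (by rw [← Hom.term_onD]; simp)

theorem IsWalk.toCore {u v : G.V} {L : List G.Dart} (h : G.IsWalk u L v) (hu : G.VInCore u)
    (hv : G.VInCore v) (hL : ∀ d ∈ L, G.EInCore d.1) :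
    G.core.Reads (toCoreV u hu) (L.map G.letter) (toCoreV v hv) := by
  induction L generalizing u with
  | nil =>
    obtain rfl : u = v := h
    exact reads_nil.2 rfl
  | cons d L ih =>
    have hd := hL d (by simp)
    obtain ⟨rfl, h2⟩ := h
    refine reads_cons.2 ⟨toCoreD d hd, init_toCoreD d hd, rfl, ?_⟩
    rw [term_toCoreD]
    exact ih h2 hd.term fun x hx => hL x (by simp [hx])

/-- A reduced word read between vertices of the core is read in the core. -/
theorem Reads.toCore (hG : {e | G.EInCore e}.Finite) {u v : G.core.V} {w : List (Letter n)}
    (hw : FreeGroup.IsReduced w) (h : G.Reads (G.coreIncl.onV u) w (G.coreIncl.onV v)) :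
    G.core.Reads u w v := by
  obtain ⟨L, hL, rfl⟩ := h
  exact hL.toCore (vInCore_onV u) (vInCore_onV v) fun d hd =>
    hL.eInCore hG (isChain_of_isReduced hw) (vInCore_onV u) (vInCore_onV v) hd

theorem core_exists_ne (v : G.core.V) (d : G.core.Dart) :
    ∃ d' : G.core.Dart, G.core.init d' = v ∧ d' ≠ d := by
  obtain ⟨d', h1, h2, h3⟩ := (vInCore_onV v).exists_ne (G.coreIncl.onD d)
  refine ⟨toCoreD d' h1, ?_, ?_⟩
  · rw [init_toCoreD]
    exact coreIncl_onV_injective h2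
  · rintro rfl
    exact h3 rfl

theorem IsFolded.core (hG : G.IsFolded) : G.core.IsFolded :=
  hG.of_hom coreIncl_onE_injective

theorem EInCore.map {f : Hom G G'} (hf : Function.Injective f.onE) {e : G.E} (h : G.EInCore e) :
    G'.EInCore (f.onE e) := by
  obtain ⟨m, c, ⟨h0, hp, ht, hr⟩, i, rfl⟩ := h
  refine ⟨m, fun i => f.onD (c i), ⟨h0, fun i => by simp [hp], fun i => ?_, fun i => ?_⟩, i, rfl⟩
  · simp [ht]
  · exact fun h => hr i (Hom.onD_injective hf h)

theorem VInCore.map {f : Hom G G'} (hf : Function.Injective f.onE) {v : G.V} (h : G.VInCore v) :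
    G'.VInCore (f.onV v) := by
  obtain ⟨d, hd, rfl⟩ := vInCore_iff.1 h
  have : G'.EInCore (f.onD d).1 := hd.map hf
  simpa using this.init

/-- A reduced cycle through the image of `e` consists of core edges, hence lies in the range of `f`
and lifts dart by dart. -/
theorem EInCore.of_map {f : Hom G G'} (hV : Function.Injective f.onV)
    (hf : Function.Injective f.onE) (hc : ∀ e, G'.EInCore e → e ∈ Set.range f.onE) {e : G.E}
    (h : G'.EInCore (f.onE e)) : G.EInCore e := by
  obtain ⟨m, c, hc', i, hi⟩ := h
  have hex (j : ℕ) : ∃ d : G.Dart, f.onD d = c j := by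
    obtain ⟨x, hx⟩ := hc (c j).1 ⟨m, c, hc', j, rfl⟩
    exact ⟨(x, (c j).2), by simp [Hom.onD, hx]⟩
  choose b hb using hex
  obtain ⟨h0, hp, ht, hr⟩ := hc'
  refine ⟨m, b, ⟨h0, fun j => Hom.onD_injective hf ?_, fun j => hV ?_, fun j hj => ?_⟩, i, hf ?_⟩
  · rw [hb, hb, hp]
  · rw [← f.term_onD, ← f.init_onD, hb, hb, ht]
  · exact hr j (by rw [← hb, ← hb, hj]; rfl)
  · rw [← hi, ← hb]; rfl

/-- An injective map whose image contains the core induces an isomorphism of core graphs. -/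
theorem nonempty_core_iso {f : Hom G G'} (hV : Function.Injective f.onV)
    (hf : Function.Injective f.onE) (hc : ∀ e, G'.EInCore e → e ∈ Set.range f.onE) :
    Nonempty (Iso G.core G'.core) := by
  refine ⟨⟨⟨fun v => toCoreV (f.onV (G.coreIncl.onV v)) ((vInCore_onV v).map hf),
    fun e => toCoreE (f.onE (G.coreIncl.onE e)) ((eInCore_onE e).map hf),
    fun e => Subtype.ext (f.src_onE _), fun e => Subtype.ext (f.tgt_onE _),
    fun e => f.lab_onE _⟩, ⟨fun u v h => Subtype.ext (hV (congrArg Subtype.val h)), ?_⟩,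
    ⟨fun u v h => Subtype.ext (hf (congrArg Subtype.val h)), ?_⟩⟩⟩
  · intro v
    obtain ⟨d, h1, hd⟩ := vInCore_iff.1 (vInCore_onV v)
    obtain ⟨x, hx⟩ := hc _ h1
    have hxd : f.onD (x, d.2) = d := by simp [Hom.onD, hx]
    have h2 : G.EInCore ((x, d.2) : G.Dart).1 := EInCore.of_map hV hf hc (by simpa [hx] using h1)
    refine ⟨toCoreV _ h2.init, coreIncl_onV_injective ?_⟩
    rw [← hd, ← hxd, Hom.init_onD]
    rfl
  · intro e
    obtain ⟨x, hx⟩ := hc _ (eInCore_onE e)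
    have h2 : G.EInCore x := EInCore.of_map hV hf hc (by rw [hx]; exact eInCore_onE e)
    exact ⟨toCoreE x h2, coreIncl_onE_injective hx⟩

end LGraph

namespace LGraph

variable {n : ℕ} {H : Subgroup (FreeGroup (Fin n))}

/-! ### The covering graph of a subgroup -/

/-- The coset `Hg` as a vertex of the covering. -/
def coset (H : Subgroup (FreeGroup (Fin n))) (g : FreeGroup (Fin n)) : (cover H).V :=
  (Quotient.mk'' g : Quotient (QuotientGroup.rightRel H))

/-- Right multiplication of a coset by a group element. -/
def cosetMul (c : (cover H).V) (g : FreeGroup (Fin n)) : (cover H).V :=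
  Quotient.map' (s₂ := QuotientGroup.rightRel H) (fun x => x * g)
    (fun x y h => by
      rw [QuotientGroup.rightRel_apply] at h ⊢
      simpa [mul_assoc] using h) (c : Quotient (QuotientGroup.rightRel H))

theorem coset_surjective (c : (cover H).V) : ∃ g, coset H g = c :=
  Quotient.inductionOn' (c : Quotient (QuotientGroup.rightRel H)) fun g => ⟨g, rfl⟩

theorem coset_eq_iff {g g' : FreeGroup (Fin n)} : coset H g = coset H g' ↔ g' * g⁻¹ ∈ H := by
  rw [← QuotientGroup.rightRel_apply]
  exact Quotient.eq''

@[simp] theorem cosetMul_coset (g g' : FreeGroup (Fin n)) :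
    cosetMul (coset H g) g' = coset H (g * g') := rfl

@[simp] theorem cosetMul_one (c : (cover H).V) : cosetMul c 1 = c := by
  obtain ⟨g, rfl⟩ := coset_surjective c
  simp

theorem cosetMul_mul (c : (cover H).V) (g g' : FreeGroup (Fin n)) :
    cosetMul c (g * g') = cosetMul (cosetMul c g) g' := by
  obtain ⟨g, rfl⟩ := coset_surjective c
  simp [mul_assoc]

theorem cosetMul_eq_iff {c c' : (cover H).V} {g : FreeGroup (Fin n)} :
    cosetMul c g = c' ↔ c = cosetMul c' g⁻¹ := by
  constructor
  · rintro rfl; simp [← cosetMul_mul]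
  · rintro rfl; simp [← cosetMul_mul]

theorem cosetMul_left_injective (g : FreeGroup (Fin n)) :
    Function.Injective fun c : (cover H).V => cosetMul c g := fun c c' h => by
  have := cosetMul_eq_iff.1 h
  simpa [← cosetMul_mul] using this

theorem toFree_false (i : Fin n) : Letter.toFree (i, false) = (FreeGroup.of i)⁻¹ := by
  simp [Letter.toFree, FreeGroup.of, FreeGroup.inv_mk, FreeGroup.invRev]

theorem cover_tgt (e : (cover H).E) :
    (cover H).tgt e = cosetMul ((cover H).src e) (FreeGroup.of ((cover H).lab e)) := rfl

theorem cover_term (d : (cover H).Dart) :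
    (cover H).term d = cosetMul ((cover H).init d) ((cover H).letter d).toFree := by
  rcases d with ⟨e, _ | _⟩
  · change (cover H).src e = cosetMul ((cover H).tgt e) (Letter.toFree ((cover H).lab e, false))
    rw [cover_tgt, toFree_false, ← cosetMul_mul]
    simp
  · exact cover_tgt e

theorem cover_edge_ext {e e' : (cover H).E} (h : (cover H).src e = (cover H).src e')
    (hl : (cover H).lab e = (cover H).lab e') : e = e' :=
  Prod.ext h hl

/-- For edges with a common target this is the injectivity of right multiplication on cosets. -/
theorem cover_isFolded (H : Subgroup (FreeGroup (Fin n))) : (cover H).IsFolded := by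
  rintro ⟨e, b⟩ ⟨e', b'⟩ h hl
  obtain rfl : b = b' := congrArg Prod.snd hl
  have hl' : (cover H).lab e = (cover H).lab e' := congrArg Prod.fst hl
  refine cover_edge_ext ?_ hl'
  cases b
  · change (cover H).tgt e = (cover H).tgt e' at h
    rw [cover_tgt, cover_tgt, hl'] at h
    exact cosetMul_left_injective _ h
  · exact h

/-- The edge of the covering with a given origin and label. -/
def coverEdge (c : (cover H).V) (i : Fin n) : (cover H).E :=
  ((c, i) : Quotient (QuotientGroup.rightRel H) × Fin n)

@[simp] theorem src_coverEdge (c : (cover H).V) (i : Fin n) :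
    (cover H).src (coverEdge c i) = c := rfl

@[simp] theorem lab_coverEdge (c : (cover H).V) (i : Fin n) :
    (cover H).lab (coverEdge c i) = i := rfl

theorem cover_exists_dart (c : (cover H).V) (l : Letter n) :
    ∃ d, (cover H).init d = c ∧ (cover H).letter d = l := by
  rcases l with ⟨i, _ | _⟩
  · refine ⟨(coverEdge (cosetMul c (FreeGroup.of i)⁻¹) i, false), ?_, rfl⟩
    change (cover H).tgt _ = c
    rw [cover_tgt, src_coverEdge, lab_coverEdge, ← cosetMul_mul]
    simp
  · exact ⟨(coverEdge c i, true), rfl, rfl⟩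

/-- Every letter leaves every coset, so in the covering any word can be read from any vertex, and
reading it is the right action of the free group. -/
theorem cover_reads_iff {c c' : (cover H).V} {w : List (Letter n)} :
    (cover H).Reads c w c' ↔ cosetMul c (FreeGroup.mk w) = c' := by
  induction w generalizing c with
  | nil => rw [reads_nil, ← FreeGroup.one_eq_mk, cosetMul_one]
  | cons l w ih =>
    have : FreeGroup.mk (l :: w) = l.toFree * FreeGroup.mk w := by
      rw [Letter.toFree, FreeGroup.mul_mk, List.singleton_append]
    rw [reads_cons, this, cosetMul_mul]
    constructor
    · rintro ⟨d, rfl, rfl, h⟩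
      rw [ih, cover_term] at h
      exact h
    · intro h
      obtain ⟨d, rfl, rfl⟩ := cover_exists_dart c l
      exact ⟨d, rfl, rfl, by rwa [ih, cover_term]⟩

theorem cover_reads_toWord {c c' : (cover H).V} {g : FreeGroup (Fin n)} :
    (cover H).Reads c g.toWord c' ↔ cosetMul c g = c' := by
  rw [cover_reads_iff, FreeGroup.mk_toWord]

theorem cosetMul_transitive (c c' : (cover H).V) : ∃ g, cosetMul c g = c' := by
  obtain ⟨g, rfl⟩ := coset_surjective c
  obtain ⟨g', rfl⟩ := coset_surjective c'
  exact ⟨g⁻¹ * g', by simp⟩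

/-! ### Words read along reduced cycles -/

variable {G : LGraph n}

/-- The list `c i, c (i + 1), …` of length `k`. -/
def cycleList (c : ℕ → G.Dart) : ℕ → ℕ → List G.Dart
  | _, 0 => []
  | i, k + 1 => c i :: cycleList c (i + 1) k

theorem isWalk_cycleList {c : ℕ → G.Dart} (hc : ∀ i, G.term (c i) = G.init (c (i + 1))) (i k : ℕ) :
    G.IsWalk (G.init (c i)) (cycleList c i k) (G.init (c (i + k))) := by
  induction k generalizing i with
  | zero => exact rfl
  | succ k ih =>
    refine ⟨rfl, ?_⟩
    rw [hc]
    convert ih (i + 1) using 3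
    omega

theorem isChain_cycleList {c : ℕ → G.Dart} (hc : ∀ i, c (i + 1) ≠ G.rev (c i)) (i k : ℕ) :
    (cycleList c i k).IsChain fun d d' => d' ≠ G.rev d := by
  induction k generalizing i with
  | zero => simp [cycleList]
  | succ k ih =>
    cases k with
    | zero => simp [cycleList]
    | succ k =>
      have := ih (i + 1)
      simp only [cycleList, List.isChain_cons_cons] at this ⊢
      exact ⟨hc i, this⟩

theorem getLast?_cycleList (c : ℕ → G.Dart) (i k : ℕ) :
    (cycleList c i (k + 1)).getLast? = some (c (i + k)) := by
  induction k generalizing i with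
  | zero => simp [cycleList]
  | succ k ih =>
    have := ih (i + 1)
    rw [cycleList, cycleList, List.getLast?_cons_cons, ← cycleList, this]
    congr 2
    omega

theorem mem_cycleList (c : ℕ → G.Dart) (i k : ℕ) {j : ℕ} (hj : j < k) :
    c (i + j) ∈ cycleList c i k := by
  induction k generalizing i j with
  | zero => omega
  | succ k ih =>
    cases j with
    | zero => simp [cycleList]
    | succ j =>
      have := ih (i + 1) (j := j) (by omega)
      rw [show i + 1 + j = i + (j + 1) by omega] at this
      exact List.mem_cons_of_mem _ this

/-- Consecutive inverse letters would be carried by two darts with the same origin and letter, the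
second dart and the reverse of the first, which foldedness makes equal. -/
theorem IsFolded.isReduced (hG : G.IsFolded) {u v : G.V} {L : List G.Dart} (h : G.IsWalk u L v)
    (hL : L.IsChain fun d d' => d' ≠ G.rev d) : FreeGroup.IsReduced (L.map G.letter) := by
  induction L generalizing u with
  | nil => simp
  | cons x L ih =>
    cases L with
    | nil => simp
    | cons y L =>
      rw [List.isChain_cons_cons] at hL
      have := ih h.2 hL.2
      simp only [List.map_cons, FreeGroup.isReduced_cons_cons] at this ⊢
      refine ⟨fun h1 => ?_, this⟩
      by_contra h2
      refine hL.1 (hG.dart_eq ?_ (Prod.ext h1.symm ?_))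
      · rw [init_rev]; exact h.2.1
      · simp only [letter_rev, Letter.inv]
        cases hx : (G.letter x).2 <;> cases hy : (G.letter y).2 <;> simp_all

/-- Reading along a walk which is known downstairs, in a graph mapping to a folded graph. -/
theorem IsFolded.mem_range_of_reads {F : LGraph n} (hG : G.IsFolded) (f : Hom F G) {x y : F.V}
    {L : List G.Dart} {v : G.V} (hL : G.IsWalk (f.onV x) L v)
    (h : F.Reads x (L.map G.letter) y) {d : G.Dart} (hd : d ∈ L) : d.1 ∈ Set.range f.onE := by
  induction L generalizing x with
  | nil => simp at hd
  | cons z L ih =>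
    rw [List.map_cons, reads_cons] at h
    obtain ⟨z', rfl, h2, h3⟩ := h
    have hz : f.onD z' = z := hG.dart_eq (by simp [hL.1]) (by simp [h2])
    rcases List.mem_cons.1 hd with rfl | hd
    · exact ⟨z'.1, by rw [← hz]; rfl⟩
    · refine ih ?_ h3 hd
      rw [← Hom.term_onD, hz]
      exact hL.2

theorem exists_minimal_norm {P : FreeGroup (Fin n) → Prop} (h : ∃ g, P g) :
    ∃ g, P g ∧ ∀ g', P g' → g.norm ≤ g'.norm := by
  obtain ⟨g, hg⟩ := exists_minimalFor_of_wellFoundedLT P FreeGroup.norm h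
  exact ⟨g, hg.1, fun g' hg' => le_of_not_gt fun hlt => absurd (hg.2 hg' hlt.le) (not_le.2 hlt)⟩

theorem cosetMul_mk_dropLast {c x : (cover H).V} {L' : List (Fin n × Bool)} {l : Letter n}
    (h : cosetMul c (FreeGroup.mk (L' ++ [l])) = x) :
    cosetMul c (FreeGroup.mk L') = cosetMul x l.inv.toFree := by
  subst h
  rw [← FreeGroup.mul_mk, ← cosetMul_mul, WhiteheadAut.toFree_inv, Letter.toFree,
    mul_inv_cancel_right]

/-- If all reduced closed words at one vertex can be read in `F`, then the image of `F` contains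
the core of the covering. -/
theorem core_subset_range {F : LGraph n} (f : Hom F (cover H)) (x₀ : F.V)
    (hF : ∀ g, cosetMul (f.onV x₀) g = f.onV x₀ → ∃ y, F.Reads x₀ g.toWord y)
    {e : (cover H).E} (he : (cover H).EInCore e) : e ∈ Set.range f.onE := by
  obtain ⟨m, c, hc, j, rfl⟩ := he
  obtain ⟨h0, hp, ht, hr⟩ := hc
  -- A shortest path from the base coset to the cycle. The cycle, reparametrized to start at the
  -- point `c i` reached, is attached to the base by this tail.
  obtain ⟨g, ⟨i, hi⟩, hg⟩ := exists_minimal_norm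
    (P := fun g => ∃ i, cosetMul (f.onV x₀) g = (cover H).init (c i))
    ((cosetMul_transitive (f.onV x₀) ((cover H).init (c 0))).imp fun g h => ⟨0, h⟩)
  obtain ⟨k, rfl⟩ : ∃ k, m = k + 1 := ⟨m - 1, by omega⟩
  have hw := isWalk_cycleList ht i (k + 1)
  rw [hp] at hw
  have hwr := (cover_isFolded H).isReduced hw (isChain_cycleList hr i (k + 1))
  set w := (cycleList c i (k + 1)).map (cover H).letter with hwdef
  have hwh : w.head? = some ((cover H).letter (c i)) := by simp [hwdef, cycleList]
  have hwl : w.getLast? = some ((cover H).letter (c (i + k))) := by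
    simp [hwdef, getLast?_cycleList]
  have hw0 : w ≠ [] := by rintro h; simp [h] at hwh
  have hread : (cover H).Reads (f.onV x₀) (g.toWord ++ w ++ FreeGroup.invRev g.toWord)
      (f.onV x₀) := by
    have h1 := cover_reads_toWord.2 hi
    exact reads_append.2 ⟨_, reads_append.2 ⟨_, h1, _, hw, rfl⟩, h1.inv⟩
  -- A cancellation between the tail and either end of `w` would mean that the tail already runs
  -- along the cycle, so dropping its last letter would reach the cycle sooner.
  have hred : FreeGroup.IsReduced (g.toWord ++ w ++ FreeGroup.invRev g.toWord) := by
    have hgr := FreeGroup.isReduced_toWord (x := g)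
    have hgr' : FreeGroup.IsReduced (FreeGroup.invRev g.toWord) := by
      rw [← FreeGroup.toWord_inv]; exact FreeGroup.isReduced_toWord
    rcases List.eq_nil_or_concat' g.toWord with hnil | ⟨L', l, hL'⟩
    · simpa [hnil] using hwr
    · have hlt : ∀ i', cosetMul (f.onV x₀) (FreeGroup.mk L') ≠ (cover H).init (c i') := by
        intro i' hi'
        have h1 := hg _ ⟨i', hi'⟩
        have h2 : (FreeGroup.mk L').norm ≤ L'.length := FreeGroup.norm_mk_le
        have h3 : g.norm = L'.length + 1 := by simp [FreeGroup.norm, hL']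
        omega
      have hstep : cosetMul (f.onV x₀) (FreeGroup.mk L')
          = cosetMul ((cover H).init (c i)) (Letter.inv l).toFree :=
        cosetMul_mk_dropLast (by rw [← hL', FreeGroup.mk_toWord, hi])
      refine FreeGroup.IsReduced.append_overlap ?_ ?_ hw0
      · refine List.isChain_append.2 ⟨hgr, hwr, ?_⟩
        intro a ha b hb h1
        rw [hwh, Option.mem_some_iff] at hb
        rw [hL', List.getLast?_concat, Option.mem_some_iff] at ha
        subst ha hb
        by_contra h2
        refine hlt (i + 1) ?_
        have h3 : Letter.inv l = (cover H).letter (c i) := by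
          refine Prod.ext h1 ?_
          simp only [Letter.inv]
          cases hx : l.2 <;> cases hy : ((cover H).letter (c i)).2 <;> simp_all
        rw [hstep, h3, ← cover_term, ht]
      · refine List.isChain_append.2 ⟨hwr, hgr', ?_⟩
        intro a ha b hb h1
        rw [hwl, Option.mem_some_iff] at ha
        have hb' : b = Letter.inv l := by
          rw [hL', FreeGroup.invRev_append] at hb
          simp [FreeGroup.invRev] at hb
          exact hb.symm
        subst ha hb'
        by_contra h2
        refine hlt (i + k) ?_
        have h3 : Letter.inv l = (cover H).letter ((cover H).rev (c (i + k))) := by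
          refine Prod.ext h1.symm ?_
          simp only [letter_rev, Letter.inv] at h2 ⊢
          cases hx : l.2 <;> cases hy : ((cover H).letter (c (i + k))).2 <;> simp_all
        have h4 : (cover H).init (c i) = (cover H).init ((cover H).rev (c (i + k))) := by
          rw [init_rev, ht, add_assoc, hp]
        rw [hstep, h3, h4, ← cover_term, term_rev]
  -- The closed word is its own normal form, so it is read in `F`, and its middle part lifts the
  -- whole cycle.
  obtain ⟨y, hy⟩ := hF _ (cover_reads_iff.1 hread)
  rw [FreeGroup.toWord_mk, hred.reduce_eq, reads_append] at hy
  obtain ⟨y₂, hy, -⟩ := hy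
  rw [reads_append] at hy
  obtain ⟨y₁, h1, h2⟩ := hy
  have h3 : f.onV y₁ = (cover H).init (c i) := by
    rw [← hi, ← cover_reads_toWord.1 (h1.map f)]
  obtain ⟨r, hr', hcr⟩ : ∃ r < k + 1, c (i + r) = c j := by
    have hper : Function.Periodic c (k + 1) := hp
    have hper' : Function.Periodic (fun r => c (i + r)) (k + 1) := fun r =>
      (congrArg c (add_assoc i r (k + 1)).symm).trans (hp (i + r))
    have hle : i ≤ i * (k + 1) := Nat.le_mul_of_pos_right _ h0
    -- The number `j + i * (k + 1)` is congruent to `j` modulo the period and is at least `i`, so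
    -- the truncated subtraction is exact.
    refine ⟨(j + i * (k + 1) - i) % (k + 1), Nat.mod_lt _ h0, ?_⟩
    refine (hper'.map_mod_nat _).trans ?_
    rw [show i + (j + i * (k + 1) - i) = j + i * (k + 1) by omega]
    exact hper.nat_mul i j
  rw [← hcr]
  exact (cover_isFolded H).mem_range_of_reads f (h3 ▸ hw) h2 (mem_cycleList c i _ hr')

/-! ### Finiteness and non-emptiness of the core -/

/-- The subgraph with the same vertices and a given set of edges. -/
def restrictE (G : LGraph n) (K : Set G.E) : LGraph n where
  V := G.V
  E := K
  src e := G.src e.1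
  tgt e := G.tgt e.1
  lab e := G.lab e.1

/-- The inclusion of a subgraph. -/
def restrictIncl (G : LGraph n) (K : Set G.E) : Hom (G.restrictE K) G :=
  ⟨id, Subtype.val, fun _ => rfl, fun _ => rfl, fun _ => rfl⟩

theorem IsWalk.restrictE {K : Set G.E} {u v : G.V} {L : List G.Dart} (h : G.IsWalk u L v)
    (hL : ∀ d ∈ L, d.1 ∈ K) : (G.restrictE K).Reads u (L.map G.letter) v := by
  induction L generalizing u with
  | nil => exact reads_nil.2 h
  | cons d L ih =>
    obtain ⟨rfl, h2⟩ := h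
    exact reads_cons.2 ⟨(⟨d.1, hL d (by simp)⟩, d.2), rfl, rfl, ih h2 fun x hx => hL x (by simp [hx])⟩

/-- Loops reading a finite generating set run over a finite set `K` of edges. The subgraph on `K` is
folded, so the normal form of every product of generators is again read there as a loop, and
`core_subset_range` puts the core inside `K`. -/
theorem finite_eInCore (hH : H.FG) : {e | (cover H).EInCore e}.Finite := by
  obtain ⟨S, hS⟩ := hH
  have hSH : ∀ s ∈ S, s ∈ H := fun s hs => hS ▸ Subgroup.subset_closure hs
  have hfix : ∀ s ∈ H, (cover H).Reads (coset H 1) s.toWord (coset H 1) := fun s hs =>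
    cover_reads_toWord.2 (by rw [cosetMul_coset, coset_eq_iff]; simpa using hs)
  choose! L hL hLw using fun s hs => hfix s hs
  let K : Set (cover H).E := ⋃ s ∈ S, {e | e ∈ (L s).map Prod.fst}
  have hK : K.Finite := S.finite_toSet.biUnion fun s _ => List.finite_toSet _
  have hfold : ((cover H).restrictE K).IsFolded :=
    (cover_isFolded H).of_hom (f := restrictIncl _ K) Subtype.val_injective
  have hread : ∀ h ∈ Subgroup.closure (S : Set (FreeGroup (Fin n))),
      ((cover H).restrictE K).Reads (coset H 1) h.toWord (coset H 1) := by
    intro h hh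
    induction hh using Subgroup.closure_induction with
    | mem s hs =>
      rw [← hLw s (hSH s hs)]
      exact (hL s (hSH s hs)).restrictE fun d hd =>
        Set.mem_biUnion hs (List.mem_map_of_mem hd)
    | one => exact reads_nil.2 rfl
    | mul a b _ _ ha hb =>
      have := hfold.reads_toWord (reads_append.2 ⟨_, ha, hb⟩)
      rwa [← FreeGroup.mul_mk, FreeGroup.mk_toWord, FreeGroup.mk_toWord] at this
    | inv a _ ha =>
      rw [FreeGroup.toWord_inv]
      exact ha.inv
  refine hK.subset fun e he => ?_
  obtain ⟨x, rfl⟩ := core_subset_range (restrictIncl _ K) (coset H 1)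
    (fun g hg => ⟨coset H 1, hread g (by
      have : cosetMul (coset H 1) g = coset H 1 := hg
      rw [cosetMul_coset, coset_eq_iff] at this
      rw [hS]
      simpa using this)⟩) he
  exact x.2

/-- A nontrivial element of `H` is `p w p⁻¹` with `w` cyclically reduced and nonempty; after the
tail `p`, the word `w` is read along a cyclically reduced closed path. -/
theorem exists_vInCore (hH : H ≠ ⊥) : ∃ v, (cover H).VInCore v := by
  obtain ⟨⟨h, hh⟩, h1⟩ := Subgroup.ne_bot_iff_exists_ne_one.1 hH
  replace h1 : h ≠ 1 := fun h' => h1 (Subtype.ext h')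
  have hconj := FreeGroup.reduceCyclically.conj_conjugator_reduceCyclically h.toWord
  set p := FreeGroup.reduceCyclically.conjugator h.toWord
  set w := FreeGroup.reduceCyclically h.toWord
  have hw : FreeGroup.IsCyclicallyReduced w :=
    FreeGroup.reduceCyclically.isCyclicallyReduced FreeGroup.isReduced_toWord
  have hread : (cover H).Reads (coset H 1) h.toWord (coset H 1) :=
    cover_reads_toWord.2 (by rw [cosetMul_coset, coset_eq_iff]; simpa using hh)
  rw [← hconj, reads_append] at hread
  obtain ⟨x, h2, h3⟩ := hread
  obtain ⟨y, h4, h5⟩ := reads_append.1 h2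
  -- Both vertices are reached from the base coset by reading `p`, so the path of `w` is closed.
  have hxy : x = y := by
    have h6 := h3.inv
    rw [FreeGroup.invRev_invRev, cover_reads_iff] at h6
    rw [cover_reads_iff] at h4
    exact h6.symm.trans h4
  subst hxy
  obtain ⟨L, hL, hLw⟩ := h5
  have hL0 : L ≠ [] := by
    rintro rfl
    refine h1 (FreeGroup.toWord_eq_nil_iff.1 ?_)
    have hw0 : w = [] := hLw.symm
    rw [hw0, List.append_nil] at hconj
    have h7 : FreeGroup.mk (p ++ FreeGroup.invRev p) = h := by rw [hconj, FreeGroup.mk_toWord]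
    rw [← FreeGroup.mul_mk, ← FreeGroup.inv_mk, mul_inv_cancel] at h7
    rw [← h7, FreeGroup.toWord_one]
  rw [← hLw] at hw
  refine ⟨_, EInCore.init (d := L.head hL0) (hL.eInCore_of_closed (isChain_of_isReduced hw.1) ?_
    (List.head_mem hL0))⟩
  intro d hd d' hd' h8
  have := hw.2 ((cover H).letter d) (by rw [List.getLast?_map, Option.mem_def.1 hd]; rfl)
    ((cover H).letter d') (by rw [List.head?_map, Option.mem_def.1 hd']; rfl)
  subst h8
  simp [Letter.inv] at this

end LGraph

namespace LGraph

variable {n : ℕ}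

/-! ### Existence and universal property of foldings -/

/-- The equivalence relation identifying `a` and `b` and nothing else. -/
def pairSetoid {α : Type} (a b : α) : Setoid α where
  r u v := u = v ∨ (u = a ∧ v = b) ∨ (u = b ∧ v = a)
  iseqv := by
    refine ⟨fun _ => .inl rfl, fun h => ?_, fun h h' => ?_⟩
    · rcases h with rfl | ⟨rfl, rfl⟩ | ⟨rfl, rfl⟩ <;> simp
    · rcases h with rfl | ⟨rfl, rfl⟩ | ⟨rfl, rfl⟩ <;> rcases h' with rfl | ⟨h1, h2⟩ | ⟨h1, h2⟩ <;>
        simp_all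

/-- The quotient of `G` by the folding operation on `d₁` and `d₂`. -/
def foldGraph (G : LGraph n) (d₁ d₂ : G.Dart) (h : G.init d₁ = G.init d₂)
    (hl : G.letter d₁ = G.letter d₂) : LGraph n where
  V := Quotient (pairSetoid (G.term d₁) (G.term d₂))
  E := Quotient (pairSetoid d₁.1 d₂.1)
  src := Quotient.map G.src (by
    obtain ⟨e₁, b₁⟩ := d₁
    obtain ⟨e₂, b₂⟩ := d₂
    -- Equal letters force equal orientations. Depending on the orientation, the two sources are the
    -- common origin or the two vertices being identified.
    obtain rfl : b₁ = b₂ := congrArg Prod.snd hl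
    rintro e e' (rfl | ⟨rfl, rfl⟩ | ⟨rfl, rfl⟩)
    · exact .inl rfl
    · cases b₁
      · exact .inr (.inl ⟨rfl, rfl⟩)
      · exact .inl h
    · cases b₁
      · exact .inr (.inr ⟨rfl, rfl⟩)
      · exact .inl h.symm)
  tgt := Quotient.map G.tgt (by
    obtain ⟨e₁, b₁⟩ := d₁
    obtain ⟨e₂, b₂⟩ := d₂
    obtain rfl : b₁ = b₂ := congrArg Prod.snd hl
    rintro e e' (rfl | ⟨rfl, rfl⟩ | ⟨rfl, rfl⟩)
    · exact .inl rfl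
    · cases b₁
      · exact .inl h
      · exact .inr (.inl ⟨rfl, rfl⟩)
    · cases b₁
      · exact .inl h.symm
      · exact .inr (.inr ⟨rfl, rfl⟩))
  lab := Quotient.lift G.lab (by
    have hl' : G.lab d₁.1 = G.lab d₂.1 := congrArg Prod.fst hl
    rintro e e' (rfl | ⟨rfl, rfl⟩ | ⟨rfl, rfl⟩)
    · rfl
    · exact hl'
    · exact hl'.symm)

/-- The quotient map of a folding operation. -/
def foldHom (G : LGraph n) (d₁ d₂ : G.Dart) (h : G.init d₁ = G.init d₂)
    (hl : G.letter d₁ = G.letter d₂) : Hom G (G.foldGraph d₁ d₂ h hl) :=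
  ⟨Quotient.mk _, Quotient.mk _, fun _ => rfl, fun _ => rfl, fun _ => rfl⟩

theorem isFold_foldHom {G : LGraph n} {d₁ d₂ : G.Dart} (hne : d₁.1 ≠ d₂.1)
    (h : G.init d₁ = G.init d₂) (hl : G.letter d₁ = G.letter d₂) :
    IsFold (G.foldHom d₁ d₂ h hl) :=
  ⟨d₁, d₂, hne, h, hl, Quotient.mk_surjective, Quotient.mk_surjective, fun _ _ => Quotient.eq,
    fun _ _ => Quotient.eq⟩

/-- Each folding identifies two distinct edges, so the number of edges drops strictly. -/
theorem IsFoldSeq.exists_maximal {G G' : LGraph n} [Finite G'.E] {f : Hom G G'}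
    (hf : IsFoldSeq f) : ∃ (F : LGraph n) (r : Hom G F), IsMaximalFolding r := by
  induction hk : Nat.card G'.E using Nat.strong_induction_on generalizing G' with
  | _ k ih =>
    by_cases hG : G'.IsFolded
    · exact ⟨G', f, hf, hG⟩
    · simp only [IsFolded, not_forall] at hG
      obtain ⟨d₁, d₂, h, hl, hne⟩ := hG
      have hg := isFold_foldHom hne h hl
      have hsurj : Function.Surjective (G'.foldHom d₁ d₂ h hl).onE := Quotient.mk_surjective
      have : Finite (G'.foldGraph d₁ d₂ h hl).E := Finite.of_surjective _ hsurj
      refine ih _ ?_ (hf.tail hg) rfl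
      subst hk
      refine lt_of_le_of_ne (Nat.card_le_card_of_surjective _ hsurj) fun hcard => hne ?_
      have hinj := (Nat.bijective_iff_surjective_and_card _).2 ⟨hsurj, hcard.symm⟩
      exact hinj.1 (Quotient.sound (.inr (.inl ⟨rfl, rfl⟩)))

theorem IsFoldSeq.surjective {G G' : LGraph n} {f : Hom G G'} (hf : IsFoldSeq f) :
    Function.Surjective f.onV ∧ Function.Surjective f.onE := by
  induction hf with
  | refl => exact ⟨Function.surjective_id, Function.surjective_id⟩
  | tail _ hg ih =>
    obtain ⟨_, _, -, -, -, hV, hE, -⟩ := hg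
    exact ⟨hV.comp ih.1, hE.comp ih.2⟩

/-- A map to a folded graph factors through each sequence of foldings. -/
theorem IsFoldSeq.exists_factor {G G' K : LGraph n} {f : Hom G G'} (hf : IsFoldSeq f)
    (hK : K.IsFolded) (p : Hom G K) :
    ∃ q : Hom G' K, (∀ v, q.onV (f.onV v) = p.onV v) ∧ ∀ e, q.onE (f.onE e) = p.onE e := by
  induction hf with
  | refl => exact ⟨p, fun _ => rfl, fun _ => rfl⟩
  | @tail G₁ G₂ f g _ hg ih =>
    obtain ⟨q, hq1, hq2⟩ := ih
    obtain ⟨d₁, d₂, -, h, hl, hV, hE, hgV, hgE⟩ := hg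
    -- Foldedness of `K` forces `q` to agree on the folded darts, hence on their ends, so `q`
    -- descends to the quotient.
    have hd : q.onD d₁ = q.onD d₂ := hK.dart_eq (by simp [h]) (by simp [hl])
    have ht : q.onV (G₁.term d₁) = q.onV (G₁.term d₂) := by
      rw [← Hom.term_onD, hd, Hom.term_onD]
    have he : q.onE d₁.1 = q.onE d₂.1 := congrArg Prod.fst hd
    have hV' (u v : G₁.V) (huv : g.onV u = g.onV v) : q.onV u = q.onV v := by
      rcases (hgV u v).1 huv with rfl | ⟨rfl, rfl⟩ | ⟨rfl, rfl⟩
      exacts [rfl, ht, ht.symm]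
    have hE' (u v : G₁.E) (huv : g.onE u = g.onE v) : q.onE u = q.onE v := by
      rcases (hgE u v).1 huv with rfl | ⟨rfl, rfl⟩ | ⟨rfl, rfl⟩
      exacts [rfl, he, he.symm]
    have h1 (v : G₁.V) : q.onV (Function.surjInv hV (g.onV v)) = q.onV v :=
      hV' _ _ (Function.surjInv_eq hV _)
    have h2 (e : G₁.E) : q.onE (Function.surjInv hE (g.onE e)) = q.onE e :=
      hE' _ _ (Function.surjInv_eq hE _)
    refine ⟨⟨fun v => q.onV (Function.surjInv hV v), fun e => q.onE (Function.surjInv hE e),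
      fun e => ?_, fun e => ?_, fun e => ?_⟩, fun v => (h1 _).trans (hq1 v),
      fun e => (h2 _).trans (hq2 e)⟩
    · obtain ⟨e, rfl⟩ := hE e
      rw [h2, g.src_onE, h1, q.src_onE]
    · obtain ⟨e, rfl⟩ := hE e
      rw [h2, g.tgt_onE, h1, q.tgt_onE]
    · obtain ⟨e, rfl⟩ := hE e
      rw [h2, g.lab_onE, q.lab_onE]

end LGraph

/-! ### The core graph of a subgroup as a full subgraph of its covering -/

namespace LGraph

variable {n : ℕ}

/-- The inclusion of the core graph of `H` into the covering. -/
def coverIncl (H : Subgroup (FreeGroup (Fin n))) : Hom (coreOf H) (cover H) := coreIncl (cover H)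

variable {H : Subgroup (FreeGroup (Fin n))}

theorem coverIncl_onV_injective : Function.Injective (coverIncl H).onV := coreIncl_onV_injective

theorem coreOf_isFolded (H : Subgroup (FreeGroup (Fin n))) : (coreOf H).IsFolded :=
  (cover_isFolded H).core

theorem coreOf_exists_ne (v : (coreOf H).V) (d : (coreOf H).Dart) :
    ∃ d' : (coreOf H).Dart, (coreOf H).init d' = v ∧ d' ≠ d := core_exists_ne v d

theorem coreOf_exists_init (v : (coreOf H).V) : ∃ d, (coreOf H).init d = v := by
  obtain ⟨d, h1, h2⟩ := vInCore_iff.1 (vInCore_onV v)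
  exact ⟨toCoreD d h1, (init_toCoreD d h1).trans (coreIncl_onV_injective h2)⟩

/-- A normal form is read without backtracking, and such a path between vertices of the core cannot
leave the core. -/
theorem coreOf_reads (hH : H.FG) {u v : (coreOf H).V} {g : FreeGroup (Fin n)}
    (h : cosetMul ((coverIncl H).onV u) g = (coverIncl H).onV v) : (coreOf H).Reads u g.toWord v :=
  (cover_reads_toWord.2 h).toCore (finite_eInCore hH) FreeGroup.isReduced_toWord

/-- An edge of the covering between two vertices of the core lies in the core. -/
theorem coreOf_exists_dart (hH : H.FG) {u v : (coreOf H).V} {l : Letter n}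
    (h : cosetMul ((coverIncl H).onV u) l.toFree = (coverIncl H).onV v) :
    ∃ d, (coreOf H).init d = u ∧ (coreOf H).letter d = l ∧ (coreOf H).term d = v := by
  have h1 := coreOf_reads hH h
  have h2 : l.toFree.toWord = [l] := by rw [Letter.toFree, FreeGroup.toWord_mk]; rfl
  rw [h2, reads_cons] at h1
  simpa only [reads_nil] using h1

theorem coreOf_term (d : (coreOf H).Dart) : (coverIncl H).onV ((coreOf H).term d) =
    cosetMul ((coverIncl H).onV ((coreOf H).init d)) ((coreOf H).letter d).toFree := by
  rw [← Hom.term_onD, cover_term, Hom.init_onD, Hom.letter_onD]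

theorem finite_coreOf_E (hH : H.FG) : Finite (coreOf H).E := finite_eInCore hH

end LGraph

namespace WhiteheadAut

open LGraph

variable {n : ℕ} (φ : WhiteheadAut n) {H : Subgroup (FreeGroup (Fin n))}

/-! ### The automorphism on words -/

open Classical in
/-- The factor which `φ` puts in front of the letter `l`. -/
def pre (l : Letter n) : List (Letter n) := if l ∈ φ.A then [φ.a] else []

/-- The unreduced word into which `φ` transforms the letter `l`. -/
def letterImage (l : Letter n) : List (Letter n) :=
  φ.pre l ++ [l] ++ FreeGroup.invRev (φ.pre l.inv)

theorem pre_of_mem {l : Letter n} (h : l ∈ φ.A) : φ.pre l = [φ.a] := by simp [pre, h]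

theorem pre_of_notMem {l : Letter n} (h : l ∉ φ.A) : φ.pre l = [] := by simp [pre, h]

theorem toMulEquiv_a : φ.toMulEquiv φ.a.toFree = φ.a.toFree := φ.toHom_a

theorem toMulEquiv_pre (l : Letter n) :
    φ.toMulEquiv (FreeGroup.mk (φ.pre l)) = FreeGroup.mk (φ.pre l) := by
  by_cases h : l ∈ φ.A
  · rw [pre_of_mem φ h]; exact φ.toMulEquiv_a
  · rw [pre_of_notMem φ h, ← FreeGroup.one_eq_mk, map_one]

theorem toMulEquiv_of (j : Fin n) : φ.toMulEquiv (FreeGroup.of j) =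
    FreeGroup.mk (φ.pre (j, true)) * FreeGroup.of j * (FreeGroup.mk (φ.pre (j, false)))⁻¹ := by
  change φ.toHom (FreeGroup.of j) = _
  rw [toHom, FreeGroup.lift_apply_of, genImage]
  by_cases h1 : (j, true) ∈ φ.A <;> by_cases h2 : (j, false) ∈ φ.A <;>
    simp [pre, h1, h2, Letter.toFree, ← FreeGroup.one_eq_mk]

/-- The formula for generators is stable under inversion, which exchanges the two outer factors;
this allows letters of both signs to be treated alike. -/
theorem toMulEquiv_toFree (l : Letter n) : φ.toMulEquiv l.toFree =
    FreeGroup.mk (φ.pre l) * l.toFree * (FreeGroup.mk (φ.pre l.inv))⁻¹ := by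
  rcases l with ⟨j, _ | _⟩
  · rw [toFree_false, map_inv, toMulEquiv_of]
    simp [mul_assoc, Letter.inv]
  · exact φ.toMulEquiv_of j

theorem mk_letterImage (l : Letter n) :
    FreeGroup.mk (φ.letterImage l) = φ.toMulEquiv l.toFree := by
  rw [toMulEquiv_toFree, letterImage, ← FreeGroup.mul_mk, ← FreeGroup.mul_mk, ← FreeGroup.inv_mk]
  rfl

theorem mk_flatMap_letterImage (w : List (Letter n)) :
    FreeGroup.mk (w.flatMap φ.letterImage) = φ.toMulEquiv (FreeGroup.mk w) := by
  induction w with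
  | nil => rw [List.flatMap_nil, ← FreeGroup.one_eq_mk, map_one]
  | cons l w ih =>
    have : FreeGroup.mk (l :: w) = l.toFree * FreeGroup.mk w := by
      rw [Letter.toFree, FreeGroup.mul_mk, List.singleton_append]
    rw [List.flatMap_cons, ← FreeGroup.mul_mk, ih, mk_letterImage, this, map_mul]

/-! ### Oriented edges of the subdivided graph -/

variable {G : LGraph n}

/-- An old vertex of the subdivided graph. -/
def oldV (G : LGraph n) (v : G.V) : (φ.subd G).V := Sum.inl v

/-- A new vertex of the subdivided graph. -/
def newV (G : LGraph n) (d : φ.ActedDart G) : (φ.subd G).V := Sum.inr d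

/-- An oriented edge which is the middle part of an oriented edge of `G`. -/
def oldD (G : LGraph n) (d : G.Dart) : (φ.subd G).Dart := (Sum.inl d.1, d.2)

/-- A new oriented edge, from the old vertex to the new one. -/
def newD (G : LGraph n) (d : φ.ActedDart G) : (φ.subd G).Dart := (Sum.inr d, φ.a.2)

open Classical in
/-- The vertex at which the middle part of an oriented edge starts. -/
def endV (G : LGraph n) (d : G.Dart) : (φ.subd G).V :=
  if h : G.letter d ∈ φ.A then φ.newV G ⟨d, h⟩ else φ.oldV G (G.init d)

variable {φ} in
theorem endV_of_mem {d : G.Dart} (h : G.letter d ∈ φ.A) : φ.endV G d = φ.newV G ⟨d, h⟩ := by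
  simp [endV, h]

variable {φ} in
theorem endV_of_notMem {d : G.Dart} (h : G.letter d ∉ φ.A) :
    φ.endV G d = φ.oldV G (G.init d) := by
  simp [endV, h]

@[simp] theorem init_oldD (d : G.Dart) : (φ.subd G).init (φ.oldD G d) = φ.endV G d := by
  rcases d with ⟨e, _ | _⟩ <;> rfl

@[simp] theorem oldD_rev (d : G.Dart) : φ.oldD G (G.rev d) = (φ.subd G).rev (φ.oldD G d) := rfl

@[simp] theorem term_oldD (d : G.Dart) :
    (φ.subd G).term (φ.oldD G d) = φ.endV G (G.rev d) := by
  rw [← init_oldD, oldD_rev, init_rev]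

@[simp] theorem letter_oldD (d : G.Dart) : (φ.subd G).letter (φ.oldD G d) = G.letter d := rfl

@[simp] theorem init_newD (d : φ.ActedDart G) :
    (φ.subd G).init (φ.newD G d) = φ.oldV G (G.init d.1) := by
  unfold newD LGraph.init
  cases h : φ.a.2 <;> simp [subd, h, oldV, LGraph.init]

@[simp] theorem term_newD (d : φ.ActedDart G) :
    (φ.subd G).term (φ.newD G d) = φ.newV G d := by
  unfold newD LGraph.term
  cases h : φ.a.2 <;> simp [subd, h, newV]

@[simp] theorem letter_newD (d : φ.ActedDart G) : (φ.subd G).letter (φ.newD G d) = φ.a := rfl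

theorem subd_dart_cases (D : (φ.subd G).Dart) : (∃ d, D = φ.oldD G d) ∨ (∃ d, D = φ.newD G d) ∨
    ∃ d, D = (φ.subd G).rev (φ.newD G d) := by
  rcases D with ⟨e | d, b⟩
  · exact .inl ⟨(e, b), rfl⟩
  · refine .inr ?_
    rcases dart_eq_or_eq_rev (d := ((Sum.inr d, b) : (φ.subd G).Dart)) (d' := φ.newD G d) rfl
      with h | h
    · exact .inl ⟨d, h⟩
    · exact .inr ⟨d, h⟩

theorem subd_vertex_cases (x : (φ.subd G).V) :
    (∃ v, x = φ.oldV G v) ∨ ∃ d, x = φ.newV G d := by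
  rcases x with v | d
  exacts [.inl ⟨v, rfl⟩, .inr ⟨d, rfl⟩]

theorem reads_pre (d : G.Dart) :
    (φ.subd G).Reads (φ.oldV G (G.init d)) (φ.pre (G.letter d)) (φ.endV G d) := by
  by_cases h : G.letter d ∈ φ.A
  · rw [pre_of_mem φ h, endV_of_mem h]
    have := reads_singleton (d := φ.newD G ⟨d, h⟩)
    simpa using this
  · rw [pre_of_notMem φ h, endV_of_notMem h, reads_nil]

theorem reads_letterImage (d : G.Dart) : (φ.subd G).Reads (φ.oldV G (G.init d))
    (φ.letterImage (G.letter d)) (φ.oldV G (G.term d)) := by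
  have h1 := reads_singleton (d := φ.oldD G d)
  have h2 := (φ.reads_pre (G.rev d)).inv
  rw [init_rev, letter_rev] at h2
  rw [init_oldD, term_oldD, letter_oldD] at h1
  exact reads_append.2 ⟨_, reads_append.2 ⟨_, φ.reads_pre d, h1⟩, h2⟩

/-- A word `w` read in `G` gives the word `φ(w)`, read in the subdivided graph. -/
theorem reads_flatMap_letterImage {u v : G.V} {w : List (Letter n)} (h : G.Reads u w v) :
    (φ.subd G).Reads (φ.oldV G u) (w.flatMap φ.letterImage) (φ.oldV G v) := by
  induction w generalizing u with
  | nil => rw [reads_nil] at h; rw [h, List.flatMap_nil, reads_nil]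
  | cons l w ih =>
    obtain ⟨d, rfl, rfl, h3⟩ := reads_cons.1 h
    rw [List.flatMap_cons, reads_append]
    exact ⟨_, φ.reads_letterImage d, ih h3⟩

/-! ### Comparison with the covering of the image -/

/-- The bijection `Hg ↦ φ(H)φ(g)` of cosets. -/
def mapCoset (H : Subgroup (FreeGroup (Fin n))) (c : (cover H).V) : (cover (φ.image H)).V :=
  Quotient.map' (s₁ := QuotientGroup.rightRel H) (s₂ := QuotientGroup.rightRel (φ.image H))
    φ.toMulEquiv (fun x y h => by
      rw [QuotientGroup.rightRel_apply] at h ⊢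
      exact ⟨_, h, by simp⟩) (c : Quotient (QuotientGroup.rightRel H))

@[simp] theorem mapCoset_coset (g : FreeGroup (Fin n)) :
    φ.mapCoset H (coset H g) = coset _ (φ.toMulEquiv g) := rfl

theorem mapCoset_injective : Function.Injective (φ.mapCoset H) := by
  intro c c' h
  obtain ⟨g, rfl⟩ := coset_surjective c
  obtain ⟨g', rfl⟩ := coset_surjective c'
  rw [mapCoset_coset, mapCoset_coset, coset_eq_iff, ← map_inv, ← map_mul] at h
  obtain ⟨x, hx, hxg⟩ := h
  rw [coset_eq_iff, ← φ.toMulEquiv.injective hxg]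
  exact hx

theorem mapCoset_cosetMul (c : (cover H).V) (g : FreeGroup (Fin n)) :
    φ.mapCoset H (cosetMul c g) = cosetMul (φ.mapCoset H c) (φ.toMulEquiv g) := by
  obtain ⟨x, rfl⟩ := coset_surjective c
  simp

/-- The coset corresponding to a vertex of the subdivided core graph. -/
def subdCoset (H : Subgroup (FreeGroup (Fin n))) : (φ.subd (coreOf H)).V → (cover H).V :=
  Sum.elim (coverIncl H).onV
    (fun d => cosetMul ((coverIncl H).onV ((coreOf H).init d.1)) φ.a.toFree)

@[simp] theorem subdCoset_oldV (v : (coreOf H).V) :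
    φ.subdCoset H (φ.oldV _ v) = (coverIncl H).onV v := rfl

@[simp] theorem subdCoset_newV (d : φ.ActedDart (coreOf H)) : φ.subdCoset H (φ.newV _ d) =
    cosetMul ((coverIncl H).onV ((coreOf H).init d.1)) φ.a.toFree := rfl

theorem subdCoset_endV (d : (coreOf H).Dart) : φ.subdCoset H (φ.endV _ d) =
    cosetMul ((coverIncl H).onV ((coreOf H).init d))
      (FreeGroup.mk (φ.pre ((coreOf H).letter d))) := by
  by_cases h : (coreOf H).letter d ∈ φ.A
  · rw [endV_of_mem h, pre_of_mem φ h]; rfl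
  · rw [endV_of_notMem h, pre_of_notMem φ h, ← FreeGroup.one_eq_mk, cosetMul_one, subdCoset_oldV]

/-- The vertices of the covering of `φ(H)` corresponding to those of the subdivided core graph. -/
def subdHomV (H : Subgroup (FreeGroup (Fin n))) (x : (φ.subd (coreOf H)).V) :
    (cover (φ.image H)).V := φ.mapCoset H (φ.subdCoset H x)

/-- This is the condition for the vertex map to extend to edges. A middle part reading `l` runs from
`φ(g)·pre l` to `φ(gl)·pre l⁻¹`, and `φ(l) = pre l · l · (pre l⁻¹)⁻¹`; for new edges it is `φ(a) =
a`. -/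
theorem subdHomV_term (D : (φ.subd (coreOf H)).Dart) :
    φ.subdHomV H ((φ.subd (coreOf H)).term D) = cosetMul (φ.subdHomV H ((φ.subd (coreOf H)).init D))
      ((φ.subd (coreOf H)).letter D).toFree := by
  have hnew (d : φ.ActedDart (coreOf H)) : φ.subdHomV H (φ.newV _ d) =
      cosetMul (φ.subdHomV H (φ.oldV _ ((coreOf H).init d.1))) φ.a.toFree := by
    rw [subdHomV, subdCoset_newV, mapCoset_cosetMul, toMulEquiv_a]
    rfl
  rcases φ.subd_dart_cases D with ⟨d, rfl⟩ | ⟨d, rfl⟩ | ⟨d, rfl⟩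
  · rw [term_oldD, init_oldD, letter_oldD]
    simp only [subdHomV, subdCoset_endV, mapCoset_cosetMul, toMulEquiv_pre]
    rw [init_rev, coreOf_term, mapCoset_cosetMul, toMulEquiv_toFree, letter_rev, ← cosetMul_mul,
      ← cosetMul_mul, inv_mul_cancel_right]
  · rw [term_newD, init_newD, letter_newD, hnew]
  · rw [term_rev, init_rev, term_newD, init_newD, letter_rev, letter_newD, hnew, ← cosetMul_mul,
      toFree_inv, mul_inv_cancel, cosetMul_one]

/-- The map from the subdivided core graph of `H` to the covering of `φ(H)`. -/
def subdHom (H : Subgroup (FreeGroup (Fin n))) :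
    Hom (φ.subd (coreOf H)) (cover (φ.image H)) where
  onV := φ.subdHomV H
  onE e := coverEdge (φ.subdHomV H ((φ.subd (coreOf H)).src e)) ((φ.subd (coreOf H)).lab e)
  src_onE _ := rfl
  tgt_onE e := (φ.subdHomV_term (e, true)).symm
  lab_onE _ := rfl

/-- Old vertices are distinguished by their cosets. New vertices with the same coset hang by
`a`-edges from the same old vertex, hence are folded together. The mixed case rests on the fullness
of the core in the covering. -/
theorem eq_of_subdCoset_eq (hH : H.FG) {F : LGraph n} (hF : F.IsFolded)
    (r : Hom (φ.subd (coreOf H)) F) {x y : (φ.subd (coreOf H)).V}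
    (h : φ.subdCoset H x = φ.subdCoset H y) : r.onV x = r.onV y := by
  have hmix (u : (coreOf H).V) (d : φ.ActedDart (coreOf H))
      (h : φ.subdCoset H (φ.oldV _ u) = φ.subdCoset H (φ.newV _ d)) :
      r.onV (φ.oldV _ u) = r.onV (φ.newV _ d) := by
    -- The `a`-edge from the origin of `d` to `u` lies in the core. As neither `a` nor its inverse
    -- is in `A`, it is not subdivided, and it folds with the new edge at `d`.
    obtain ⟨d', h1, h2, rfl⟩ := coreOf_exists_dart hH h.symm
    have h3 : (coreOf H).letter d' ∉ φ.A := h2 ▸ φ.a_notMem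
    have h4 : (coreOf H).letter ((coreOf H).rev d') ∉ φ.A := by
      rw [letter_rev, h2]; exact φ.inv_notMem
    have h5 : r.onD (φ.oldD _ d') = r.onD (φ.newD _ d) :=
      hF.dart_eq (by simp [endV_of_notMem h3, h1]) (by simp [h2])
    have h6 := congrArg F.term h5
    simpa [endV_of_notMem h4] using h6
  rcases φ.subd_vertex_cases x with ⟨u, rfl⟩ | ⟨d, rfl⟩ <;>
    rcases φ.subd_vertex_cases y with ⟨v, rfl⟩ | ⟨d', rfl⟩
  · rw [coverIncl_onV_injective h]
  · exact hmix u d' h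
  · exact (hmix v d h.symm).symm
  · have h1 := coverIncl_onV_injective (cosetMul_left_injective _ h)
    have h2 : r.onD (φ.newD _ d) = r.onD (φ.newD _ d') :=
      hF.dart_eq (by simp [h1]) (by simp)
    have h3 := congrArg F.term h2
    simpa using h3

/-- The folded graph embeds into the covering of `φ(H)`. -/
theorem exists_embedding (hH : H.FG) {F : LGraph n} {r : Hom (φ.subd (coreOf H)) F}
    (hr : IsMaximalFolding r) : ∃ f : Hom F (cover (φ.image H)),
      (∀ x, f.onV (r.onV x) = φ.subdHomV H x) ∧ Function.Injective f.onV ∧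
        Function.Injective f.onE := by
  obtain ⟨f, hf, -⟩ := hr.1.exists_factor (cover_isFolded _) (φ.subdHom H)
  have hV : Function.Injective f.onV := by
    intro x y hxy
    obtain ⟨x, rfl⟩ := hr.1.surjective.1 x
    obtain ⟨y, rfl⟩ := hr.1.surjective.1 y
    rw [hf, hf] at hxy
    exact φ.eq_of_subdCoset_eq hH hr.2 r (φ.mapCoset_injective hxy)
  exact ⟨f, hf, hV, Hom.onE_injective_of_folded hr.2 hV⟩

/-- Questions about identifications in `F` thus become questions about cosets of `H`, independently
of the sequence of foldings. -/
theorem onV_eq_iff (hH : H.FG) {F : LGraph n} {r : Hom (φ.subd (coreOf H)) F}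
    (hr : IsMaximalFolding r) {x y : (φ.subd (coreOf H)).V} :
    r.onV x = r.onV y ↔ φ.subdCoset H x = φ.subdCoset H y := by
  refine ⟨fun h => ?_, fun h => φ.eq_of_subdCoset_eq hH hr.2 r h⟩
  obtain ⟨f, hf, -⟩ := φ.exists_embedding hH hr
  have := congrArg f.onV h
  rw [hf, hf] at this
  exact φ.mapCoset_injective this

/-- If `g` fixes the image of `v₀`, then `φ⁻¹(g)` fixes `v₀` and its normal form is read along a
loop in the core of `H`. Applying `φ` letter by letter and reducing in the folded graph yields a
loop reading the normal form of `g`. -/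
theorem nonempty_core_iso (hH : H.FG) (hne : H ≠ ⊥) {F : LGraph n}
    {r : Hom (φ.subd (coreOf H)) F} (hr : IsMaximalFolding r) :
    Nonempty (Iso F.core (coreOf (φ.image H))) := by
  obtain ⟨f, hf, hV, hE⟩ := φ.exists_embedding hH hr
  refine LGraph.nonempty_core_iso hV hE fun e he => ?_
  obtain ⟨v, hv⟩ := exists_vInCore hne
  let v₀ : (coreOf H).V := toCoreV v hv
  refine core_subset_range f (r.onV (φ.oldV _ v₀)) (fun g hg => ⟨r.onV (φ.oldV _ v₀), ?_⟩) he
  have h1 : cosetMul ((coverIncl H).onV v₀) (φ.toMulEquiv.symm g) = (coverIncl H).onV v₀ := by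
    refine φ.mapCoset_injective ?_
    rw [hf] at hg
    rw [mapCoset_cosetMul, MulEquiv.apply_symm_apply]
    exact hg
  have h2 := hr.2.reads_toWord ((φ.reads_flatMap_letterImage (coreOf_reads hH h1)).map r)
  rwa [mk_flatMap_letterImage, FreeGroup.mk_toWord, MulEquiv.apply_symm_apply] at h2

theorem exists_maximalFolding (hH : H.FG) :
    ∃ (F : LGraph n) (r : Hom (φ.subd (coreOf H)) F), IsMaximalFolding r := by
  have := finite_coreOf_E hH
  have : Finite (φ.ActedDart (coreOf H)) := inferInstance
  have : Finite (φ.subd (coreOf H)).E :=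
    inferInstanceAs (Finite ((coreOf H).E ⊕ φ.ActedDart (coreOf H)))
  exact (IsFoldSeq.refl _).exists_maximal

end WhiteheadAut

namespace WhiteheadAut

open LGraph

variable {n : ℕ} {φ : WhiteheadAut n} {H : Subgroup (FreeGroup (Fin n))}

/-! ### Consequences of the trichotomy -/

theorem mem_letters {G : LGraph n} (d : G.Dart) : G.letter d ∈ G.letters (G.init d) := ⟨d, rfl, rfl⟩

theorem CaseI.letter_notMem {G : LGraph n} {d : G.Dart} (h : φ.CaseI G (G.init d)) :
    G.letter d ∉ φ.A := fun hd => by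
  have : G.letter d ∈ G.letters (G.init d) ∩ φ.A := ⟨mem_letters d, hd⟩
  rw [h] at this
  exact this

theorem exists_actedDart {G : LGraph n} {v : G.V} (h : ¬ φ.CaseI G v) :
    ∃ d : φ.ActedDart G, G.init d.1 = v := by
  obtain ⟨l, ⟨d, h1, h2⟩, hl⟩ := Set.nonempty_iff_ne_empty.2 h
  exact ⟨⟨d, h2 ▸ hl⟩, h1⟩

theorem not_caseI {G : LGraph n} (d : φ.ActedDart G) : ¬ φ.CaseI G (G.init d.1) :=
  fun h => h.letter_notMem d.2

theorem Trichotomy.not_caseI (hφ : φ.Trichotomy H) {v : (coreOf H).V}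
    (h : φ.CaseIII (coreOf H) v) : ¬ φ.CaseI (coreOf H) v := by
  have := hφ v
  tauto

theorem Trichotomy.letter_mem (hφ : φ.Trichotomy H) {d : (coreOf H).Dart}
    (h : ¬ φ.CaseI (coreOf H) ((coreOf H).init d)) :
    (coreOf H).letter d ∈ φ.A ∨
      (coreOf H).letter d = φ.a ∧ φ.CaseIII (coreOf H) ((coreOf H).init d) := by
  rcases hφ ((coreOf H).init d) with h' | h' | h'
  · exact absurd h'.1 h
  · exact .inl (h'.2.1 (mem_letters d))
  · rcases h'.2.2.2 (mem_letters d) with h1 | h1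
    exacts [.inl h1, .inr ⟨h1, h'.2.2⟩]

theorem Trichotomy.caseIII (hφ : φ.Trichotomy H) {d : (coreOf H).Dart}
    (h : ¬ φ.CaseI (coreOf H) ((coreOf H).init d)) (hd : (coreOf H).letter d = φ.a) :
    φ.CaseIII (coreOf H) ((coreOf H).init d) := by
  rcases hφ.letter_mem h with h1 | h1
  · exact absurd (hd ▸ h1) φ.a_notMem
  · exact h1.2

theorem Trichotomy.caseI_of_letter (hφ : φ.Trichotomy H) {d : (coreOf H).Dart}
    (hd : (coreOf H).letter d = φ.a.inv) : φ.CaseI (coreOf H) ((coreOf H).init d) := by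
  by_contra h
  rcases hφ.letter_mem h with h1 | h1
  · exact φ.inv_notMem (hd ▸ h1)
  · exact φ.a.inv_ne (hd ▸ h1.1)

/-- The inverse of `a` is a letter at the end of an `a`-edge and belongs neither to `A` nor to `A ∪
{a}`, which rules out cases (ii) and (iii). -/
theorem Trichotomy.caseI_term (hφ : φ.Trichotomy H) {d : (coreOf H).Dart}
    (hd : (coreOf H).letter d = φ.a) : φ.CaseI (coreOf H) ((coreOf H).term d) := by
  rw [← init_rev]
  exact hφ.caseI_of_letter (by rw [letter_rev, hd])

theorem mem_collapsed_iff {G : LGraph n} {d : G.Dart} : d.1 ∈ φ.collapsed G ↔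
    (G.letter d = φ.a ∧ φ.CaseIII G (G.init d)) ∨
      (G.letter d = φ.a.inv ∧ φ.CaseIII G (G.term d)) := by
  constructor
  · rintro ⟨d', h, h1, h2⟩
    rcases dart_eq_or_eq_rev h.symm with rfl | rfl
    · exact .inl ⟨h1, h2⟩
    · exact .inr ⟨by rw [letter_rev, h1], by rwa [term_rev]⟩
  · rintro (h | h)
    · exact ⟨d, rfl, h⟩
    · exact ⟨G.rev d, rfl, by rw [letter_rev, h.1, Letter.inv_inv], by rw [init_rev]; exact h.2⟩

theorem notMem_collapsed_of_mem {G : LGraph n} {d : G.Dart} (h : G.letter d ∈ φ.A) :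
    d.1 ∉ φ.collapsed G := fun hd => by
  rcases mem_collapsed_iff.1 hd with h1 | h1
  · exact φ.a_notMem (h1.1 ▸ h)
  · exact φ.inv_notMem (h1.1 ▸ h)

/-- Collapsed edges run from case (iii) to case (i) vertices, and by foldedness at most one starts
or ends at a given vertex. They are therefore pairwise disjoint, and collapsing them only identifies
vertices in pairs. -/
theorem Trichotomy.collapsed_unique (hφ : φ.Trichotomy H) {d d' : (coreOf H).Dart}
    (hd : d.1 ∈ φ.collapsed (coreOf H)) (hd' : d'.1 ∈ φ.collapsed (coreOf H))
    (h : (coreOf H).init d = (coreOf H).init d') : d = d' := by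
  rcases mem_collapsed_iff.1 hd with h1 | h1 <;> rcases mem_collapsed_iff.1 hd' with h2 | h2
  · exact (coreOf_isFolded H).dart_eq h (h1.1.trans h2.1.symm)
  · exact absurd (h ▸ hφ.caseI_of_letter h2.1) (hφ.not_caseI h1.2)
  · exact absurd (h ▸ hφ.caseI_of_letter h1.1) (hφ.not_caseI h2.2)
  · exact (coreOf_isFolded H).dart_eq h (h1.1.trans h2.1.symm)

theorem Trichotomy.collapsed_init_ne (hφ : φ.Trichotomy H) {d : (coreOf H).Dart}
    (hd : d.1 ∈ φ.collapsed (coreOf H)) : (coreOf H).init d ≠ (coreOf H).term d := fun h => by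
  have := hφ.collapsed_unique (d' := (coreOf H).rev d) hd hd (by rw [init_rev, h])
  exact rev_ne d this.symm

/-! ### The collapsed graph inside the folded graph -/

variable {F : LGraph n} {r : Hom (φ.subd (coreOf H)) F}

open Classical in
/-- The image of a vertex of the core graph under folding and retracting. -/
def retractV (r : Hom (φ.subd (coreOf H)) F) (v : (coreOf H).V) : F.V :=
  if h : ∃ d : φ.ActedDart (coreOf H), (coreOf H).init d.1 = v then r.onV (φ.newV _ h.choose)
  else r.onV (φ.oldV _ v)

theorem retractV_of_caseI {v : (coreOf H).V} (h : φ.CaseI (coreOf H) v) :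
    retractV r v = r.onV (φ.oldV _ v) := by
  have : ¬ ∃ d : φ.ActedDart (coreOf H), (coreOf H).init d.1 = v := by
    rintro ⟨d, rfl⟩
    exact not_caseI d h
  simp [retractV, this]

/-- All new vertices at one old vertex are folded together, so the choice made in `retractV` is
immaterial. -/
theorem retractV_actedDart (hH : H.FG) (hr : IsMaximalFolding r) (d : φ.ActedDart (coreOf H)) :
    retractV r ((coreOf H).init d.1) = r.onV (φ.newV _ d) := by
  have h : ∃ d' : φ.ActedDart (coreOf H), (coreOf H).init d'.1 = (coreOf H).init d.1 := ⟨d, rfl⟩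
  rw [retractV, dif_pos h, φ.onV_eq_iff hH hr, subdCoset_newV, subdCoset_newV, h.choose_spec]

/-- Hence non-collapsed edges have the same incidences in `F` as in `Q`: outside case (i) a dart
either has its letter in `A` and starts from a new vertex, or is collapsed. -/
theorem retractV_endV (hH : H.FG) (hr : IsMaximalFolding r) (hφ : φ.Trichotomy H)
    {d : (coreOf H).Dart} (hd : d.1 ∉ φ.collapsed (coreOf H)) :
    r.onV (φ.endV _ d) = retractV r ((coreOf H).init d) := by
  by_cases h : φ.CaseI (coreOf H) ((coreOf H).init d)
  · rw [retractV_of_caseI h, endV_of_notMem h.letter_notMem]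
  · rcases hφ.letter_mem h with h1 | h1
    · rw [endV_of_mem h1, retractV_actedDart hH hr ⟨d, h1⟩]
    · exact absurd (mem_collapsed_iff.2 (.inl h1)) hd

/-- The case (iii) end `Hg` is moved to the coset `Hga`, which is the other end; that one is in case
(i) and stays in place. -/
theorem retractV_collapsed (hH : H.FG) (hr : IsMaximalFolding r) (hφ : φ.Trichotomy H)
    {d : (coreOf H).Dart} (hd : d.1 ∈ φ.collapsed (coreOf H)) :
    retractV r ((coreOf H).init d) = retractV r ((coreOf H).term d) := by
  have key {d : (coreOf H).Dart} (h1 : (coreOf H).letter d = φ.a)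
      (h2 : φ.CaseIII (coreOf H) ((coreOf H).init d)) :
      retractV r ((coreOf H).init d) = retractV r ((coreOf H).term d) := by
    obtain ⟨d', hd'⟩ := exists_actedDart (hφ.not_caseI h2)
    rw [retractV_of_caseI (hφ.caseI_term h1), ← hd', retractV_actedDart hH hr,
      φ.onV_eq_iff hH hr, subdCoset_newV, subdCoset_oldV, coreOf_term, hd', h1]
  rcases mem_collapsed_iff.1 hd with h | h
  · exact key h.1 h.2
  · have := key (d := (coreOf H).rev d) (by rw [letter_rev, h.1, Letter.inv_inv])
      (by rw [init_rev]; exact h.2)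
    rw [init_rev, term_rev] at this
    exact this.symm

/-- Two vertices that both move, or both stay, have distinct images. If `u` moves and `v` stays,
then `v` is `u` multiplied by `a`, and the `a`-edge joining them, which lies in the core, is
collapsed. -/
theorem eq_or_collapsed_of_retractV_eq (hH : H.FG) (hr : IsMaximalFolding r)
    (hφ : φ.Trichotomy H) {u v : (coreOf H).V} (h : retractV r u = retractV r v) :
    u = v ∨ ∃ d : (coreOf H).Dart, d.1 ∈ φ.collapsed (coreOf H) ∧
      (coreOf H).init d = u ∧ (coreOf H).term d = v := by
  have key {u v : (coreOf H).V} (hu : ¬ φ.CaseI (coreOf H) u) (hv : φ.CaseI (coreOf H) v)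
      (h : retractV r u = retractV r v) : ∃ d : (coreOf H).Dart,
      d.1 ∈ φ.collapsed (coreOf H) ∧ (coreOf H).init d = u ∧ (coreOf H).term d = v := by
    obtain ⟨d, rfl⟩ := exists_actedDart hu
    rw [retractV_of_caseI hv, retractV_actedDart hH hr, φ.onV_eq_iff hH hr] at h
    obtain ⟨d', h1, h2, h3⟩ := coreOf_exists_dart hH h
    rw [← h1] at hu
    exact ⟨d', mem_collapsed_iff.2 (.inl ⟨h2, hφ.caseIII hu h2⟩), h1, h3⟩
  by_cases hu : φ.CaseI (coreOf H) u <;> by_cases hv : φ.CaseI (coreOf H) v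
  · rw [retractV_of_caseI hu, retractV_of_caseI hv, φ.onV_eq_iff hH hr] at h
    exact .inl (coverIncl_onV_injective h)
  · obtain ⟨d, h1, h2, h3⟩ := key hv hu h.symm
    exact .inr ⟨(coreOf H).rev d, h1, by rw [init_rev, h3], by rw [term_rev, h2]⟩
  · exact .inr (key hu hv h)
  · obtain ⟨d, rfl⟩ := exists_actedDart hu
    obtain ⟨d', rfl⟩ := exists_actedDart hv
    rw [retractV_actedDart hH hr, retractV_actedDart hH hr, φ.onV_eq_iff hH hr] at h
    exact .inl (coverIncl_onV_injective (cosetMul_left_injective _ h))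

theorem exists_dart_lift (hr : IsMaximalFolding r) (D : F.Dart) :
    ∃ D' : (φ.subd (coreOf H)).Dart, r.onD D' = D := by
  obtain ⟨e, he⟩ := hr.1.surjective.2 D.1
  exact ⟨(e, D.2), Prod.ext he rfl⟩

/-- Where `φ` acts on some letter at `v`, the vertex `v` becomes a vertex of valence one. -/
theorem eq_newD_of_init_eq (hH : H.FG) (hr : IsMaximalFolding r) (hφ : φ.Trichotomy H)
    (d : φ.ActedDart (coreOf H)) {D : F.Dart}
    (hD : F.init D = r.onV (φ.oldV _ ((coreOf H).init d.1))) : D = r.onD (φ.newD _ d) := by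
  refine hr.2.dart_eq (by simpa using hD) ?_
  obtain ⟨D, rfl⟩ := exists_dart_lift hr D
  have hv := not_caseI d
  -- An `a`-edge of the core ends only in case (i), so no new vertex is folded onto this old vertex.
  have hno (u : (coreOf H).V) : cosetMul ((coverIncl H).onV u) φ.a.toFree ≠
      (coverIncl H).onV ((coreOf H).init d.1) := fun h => by
    obtain ⟨d', -, h2, h3⟩ := coreOf_exists_dart hH h
    exact hv (h3 ▸ hφ.caseI_term h2)
  rw [Hom.init_onD, φ.onV_eq_iff hH hr, subdCoset_oldV] at hD
  rw [Hom.letter_onD, Hom.letter_onD, letter_newD]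
  rcases φ.subd_dart_cases D with ⟨d', rfl⟩ | ⟨d', rfl⟩ | ⟨d', rfl⟩
  · rw [init_oldD] at hD
    rw [letter_oldD]
    by_cases h : (coreOf H).letter d' ∈ φ.A
    · rw [endV_of_mem h, subdCoset_newV] at hD
      exact absurd hD (hno _)
    · rw [endV_of_notMem h, subdCoset_oldV] at hD
      rw [← coverIncl_onV_injective hD] at hv
      exact ((hφ.letter_mem hv).resolve_left h).1
  · rfl
  · rw [init_rev, term_newD, subdCoset_newV] at hD
    exact absurd hD (hno _)

theorem existsUnique_newD (hH : H.FG) (hr : IsMaximalFolding r) (hφ : φ.Trichotomy H)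
    (d : φ.ActedDart (coreOf H)) :
    ∃! D : F.Dart, F.init D = F.init (r.onD (φ.newD _ d)) :=
  ⟨_, rfl, fun _ hD => eq_newD_of_init_eq hH hr hφ d (by simpa using hD)⟩

theorem term_newD_eq (hH : H.FG) (hr : IsMaximalFolding r) (d : φ.ActedDart (coreOf H)) :
    F.term (r.onD (φ.newD _ d)) = retractV r ((coreOf H).init d.1) := by
  rw [retractV_actedDart hH hr, Hom.term_onD, term_newD]

/-- A collapsed edge is folded with a new edge. -/
theorem oldD_eq_newD (hH : H.FG) (hr : IsMaximalFolding r) (hφ : φ.Trichotomy H)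
    {d : (coreOf H).Dart} (h1 : (coreOf H).letter d = φ.a)
    (h2 : φ.CaseIII (coreOf H) ((coreOf H).init d)) :
    ∃ d' : φ.ActedDart (coreOf H), (coreOf H).init d'.1 = (coreOf H).init d ∧
      r.onD (φ.oldD _ d) = r.onD (φ.newD _ d') := by
  obtain ⟨d', hd'⟩ := exists_actedDart (hφ.not_caseI h2)
  refine ⟨d', hd', eq_newD_of_init_eq hH hr hφ d' ?_⟩
  rw [Hom.init_onD, init_oldD, endV_of_notMem (h1 ▸ φ.a_notMem), hd']

/-- Valence at least two survives the collapse. If the second dart at the vertex is collapsed, cross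
it and leave its far end by another dart, which is not collapsed because collapsed edges are
disjoint. -/
theorem exists_notMem_collapsed (hH : H.FG) (hr : IsMaximalFolding r) (hφ : φ.Trichotomy H)
    (d₀ : (coreOf H).Dart) : ∃ d : (coreOf H).Dart, d.1 ∉ φ.collapsed (coreOf H) ∧
      retractV r ((coreOf H).init d) = retractV r ((coreOf H).init d₀) ∧ d ≠ d₀ := by
  obtain ⟨d₁, h1, h2⟩ := coreOf_exists_ne ((coreOf H).init d₀) d₀
  by_cases h3 : d₁.1 ∈ φ.collapsed (coreOf H)
  · obtain ⟨d₂, h4, h5⟩ := coreOf_exists_ne ((coreOf H).term d₁) ((coreOf H).rev d₁)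
    have h6 : d₂.1 ∉ φ.collapsed (coreOf H) := fun h =>
      h5 (hφ.collapsed_unique h (d' := (coreOf H).rev d₁) h3 (by rw [init_rev, h4]))
    refine ⟨d₂, h6, by rw [h4, ← h1, retractV_collapsed hH hr hφ h3], ?_⟩
    rintro rfl
    exact hφ.collapsed_init_ne h3 (h1.trans h4)
  · exact ⟨d₁, h3, by rw [h1], h2⟩

/-- The image in the folded graph of an edge of the core graph. -/
def midE (r : Hom (φ.subd (coreOf H)) F) (e : (coreOf H).E) : F.E :=
  r.onE (Sum.inl e : (coreOf H).E ⊕ φ.ActedDart (coreOf H))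

/-- The letter fixes the factor `pre`, which can be cancelled from the coset where the middle part
starts; this recovers the origin of the edge. -/
theorem midE_injective (hH : H.FG) (hr : IsMaximalFolding r) : Function.Injective (midE r) := by
  intro e e' h
  have h1 : r.onD (φ.oldD _ (e, true)) = r.onD (φ.oldD _ (e', true)) := Prod.ext h rfl
  have hl : (coreOf H).letter (e, true) = (coreOf H).letter (e', true) := by
    have := congrArg F.letter h1
    simpa using this
  have h2 := congrArg F.init h1
  rw [Hom.init_onD, Hom.init_onD, φ.onV_eq_iff hH hr, init_oldD, init_oldD, subdCoset_endV,
    subdCoset_endV, hl] at h2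
  exact coreOf_isFolded H (e, true) (e', true)
    (coverIncl_onV_injective (cosetMul_left_injective _ h2)) hl

theorem onD_oldD_injective (hH : H.FG) (hr : IsMaximalFolding r) :
    Function.Injective fun d => r.onD (φ.oldD _ d) := fun _ _ h =>
  Prod.ext (midE_injective hH hr (congrArg Prod.fst h)) (congrArg Prod.snd h :)

/-- The images of the non-collapsed edges form a finite subgraph without valence-one vertices. -/
theorem eInCore_midE (hH : H.FG) (hr : IsMaximalFolding r) (hφ : φ.Trichotomy H)
    {e : (coreOf H).E} (he : e ∉ φ.collapsed (coreOf H)) : F.EInCore (midE r e) := by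
  have := finite_coreOf_E hH
  refine eInCore_of_finite (X := midE r '' {e | e ∉ φ.collapsed (coreOf H)}) (Set.toFinite _) ?_
    ⟨e, he, rfl⟩
  rintro D ⟨e', he', hD⟩
  obtain ⟨d, hdD, hd⟩ : ∃ d : (coreOf H).Dart, r.onD (φ.oldD _ d) = D ∧
      d.1 ∉ φ.collapsed (coreOf H) := ⟨(e', D.2), Prod.ext hD rfl, he'⟩
  subst hdD
  obtain ⟨d', h1, h2, h3⟩ := exists_notMem_collapsed hH hr hφ d
  refine ⟨r.onD (φ.oldD _ d'), ⟨d'.1, h1, rfl⟩, ?_, fun h => h3 (onD_oldD_injective hH hr h)⟩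
  rw [Hom.init_onD, Hom.init_onD, init_oldD, init_oldD, retractV_endV hH hr hφ h1,
    retractV_endV hH hr hφ hd, h2]

/-- Each edge of the folded graph lies in the core or is one of the new edges, and these have a
vertex of valence one. -/
theorem edge_cases (hH : H.FG) (hr : IsMaximalFolding r) (hφ : φ.Trichotomy H) (x : F.E) :
    (∃ e ∉ φ.collapsed (coreOf H), midE r e = x) ∨
      ∃ d : φ.ActedDart (coreOf H), (r.onD (φ.newD _ d)).1 = x := by
  obtain ⟨y, rfl⟩ := hr.1.surjective.2 x
  rcases y with e | d
  · by_cases he : e ∈ φ.collapsed (coreOf H)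
    · obtain ⟨d, rfl, h1, h2⟩ := he
      obtain ⟨d', -, h3⟩ := oldD_eq_newD hH hr hφ h1 h2
      exact .inr ⟨d', by rw [← h3]; rfl⟩
    · exact .inl ⟨e, he, rfl⟩
  · exact .inr ⟨d, rfl⟩

theorem exists_midE_of_eInCore (hH : H.FG) (hr : IsMaximalFolding r) (hφ : φ.Trichotomy H)
    {x : F.E} (hx : F.EInCore x) : ∃ e ∉ φ.collapsed (coreOf H), midE r e = x := by
  refine (edge_cases hH hr hφ x).resolve_right ?_
  rintro ⟨d, rfl⟩
  exact not_eInCore_of_existsUnique (existsUnique_newD hH hr hφ d) hx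

theorem vInCore_retractV (hH : H.FG) (hr : IsMaximalFolding r) (hφ : φ.Trichotomy H)
    (v : (coreOf H).V) : F.VInCore (retractV r v) := by
  obtain ⟨d₀, rfl⟩ := coreOf_exists_init v
  obtain ⟨d, h1, h2, -⟩ := exists_notMem_collapsed hH hr hφ d₀
  have h3 : F.EInCore (r.onD (φ.oldD _ d)).1 := eInCore_midE hH hr hφ h1
  have h4 := h3.init
  rwa [Hom.init_onD, init_oldD, retractV_endV hH hr hφ h1, h2] at h4

theorem exists_retractV_of_vInCore (hH : H.FG) (hr : IsMaximalFolding r) (hφ : φ.Trichotomy H)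
    {y : F.V} (hy : F.VInCore y) : ∃ v, retractV r v = y := by
  obtain ⟨D, hD, rfl⟩ := vInCore_iff.1 hy
  obtain ⟨e, he, hx⟩ := exists_midE_of_eInCore hH hr hφ hD
  obtain ⟨d, hd, hdc⟩ : ∃ d : (coreOf H).Dart, r.onD (φ.oldD _ d) = D ∧
      d.1 ∉ φ.collapsed (coreOf H) := ⟨(e, D.2), Prod.ext hx rfl, he⟩
  refine ⟨(coreOf H).init d, ?_⟩
  rw [← retractV_endV hH hr hφ hdc, ← hd, Hom.init_onD, init_oldD]

/-- The isomorphism from the collapsed core graph to the core of the folded graph. -/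
def quotientIso (hH : H.FG) (hr : IsMaximalFolding r) (hφ : φ.Trichotomy H) :
    Iso (φ.quotientGraph H) F.core where
  onV := Quot.lift (fun v => toCoreV (retractV r v) (vInCore_retractV hH hr hφ v)) (by
    rintro _ _ ⟨e, he, rfl, rfl⟩
    exact Subtype.ext (retractV_collapsed hH hr hφ (d := (e, true)) he))
  onE e := toCoreE (midE r e.1) (eInCore_midE hH hr hφ e.2)
  src_onE e := by
    refine coreIncl_onV_injective ?_
    have h := retractV_endV hH hr hφ (d := (e.1, true)) e.2
    rw [← init_oldD, ← Hom.init_onD] at h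
    exact h
  tgt_onE e := by
    refine coreIncl_onV_injective ?_
    have h := retractV_endV hH hr hφ (d := (e.1, false)) e.2
    rw [← init_oldD, ← Hom.init_onD] at h
    exact h
  lab_onE e := r.lab_onE _
  bijective_onV := by
    refine ⟨?_, fun y => ?_⟩
    · rintro ⟨u⟩ ⟨v⟩ h
      have h' : retractV r u = retractV r v := congrArg F.coreIncl.onV h
      rcases eq_or_collapsed_of_retractV_eq hH hr hφ h' with rfl | ⟨⟨e, _ | _⟩, hd, rfl, rfl⟩
      · rfl
      · exact (Quot.sound ⟨e, hd, rfl, rfl⟩).symm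
      · exact Quot.sound ⟨e, hd, rfl, rfl⟩
    · obtain ⟨v, hv⟩ := exists_retractV_of_vInCore hH hr hφ (vInCore_onV y)
      exact ⟨Quot.mk _ v, coreIncl_onV_injective hv⟩
  bijective_onE := by
    refine ⟨fun e e' h => ?_, fun x => ?_⟩
    · exact Subtype.ext (midE_injective hH hr (congrArg F.coreIncl.onE h))
    · obtain ⟨e, he, hx⟩ := exists_midE_of_eInCore hH hr hφ (eInCore_onE x)
      exact ⟨⟨e, he⟩, coreIncl_onE_injective hx⟩

end WhiteheadAut

namespace LGraph

variable {n : ℕ} {G G' : LGraph n}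

/-! ### Maps between realizations -/

theorem realization_cases (p : G.Realization) :
    (∃ v, p = G.vert v) ∨ ∃ e t, p = G.edgePath e t := by
  rcases p with ⟨v | ⟨e, t⟩⟩
  exacts [.inl ⟨v, rfl⟩, .inr ⟨e, t, rfl⟩]

@[simp] theorem lift_vert {Y : Type} [TopologicalSpace Y] (fV : G.V → Y)
    (fE : ∀ e, Path (fV (G.src e)) (fV (G.tgt e))) (v : G.V) :
    G.lift fV fE (G.vert v) = fV v := rfl

@[simp] theorem lift_edgePath {Y : Type} [TopologicalSpace Y] (fV : G.V → Y)
    (fE : ∀ e, Path (fV (G.src e)) (fV (G.tgt e))) (e : G.E) (t : I) :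
    G.lift fV fE (G.edgePath e t) = fE e t := rfl

@[simp] theorem Hom.real_vert (f : Hom G G') (v : G.V) :
    f.real (G.vert v) = G'.vert (f.onV v) := rfl

@[simp] theorem Hom.real_edgePath (f : Hom G G') (e : G.E) (t : I) :
    f.real (G.edgePath e t) = G'.edgePath (f.onE e) t := rfl

@[simp] theorem Hom.real_dartPath (f : Hom G G') (d : G.Dart) (t : I) :
    f.real (G.dartPath d t) = G'.dartPath (f.onD d) t := by
  rcases d with ⟨e, _ | _⟩ <;> rfl

theorem exists_dartPath_eq (d : G.Dart) (t : I) : ∃ t', G.edgePath d.1 t = G.dartPath d t' := by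
  rcases d with ⟨e, _ | _⟩
  · exact ⟨unitInterval.symm t, congrArg (G.edgePath e) (unitInterval.symm_symm t).symm⟩
  · exact ⟨t, rfl⟩

theorem exists_edgePath_eq (d : G.Dart) (t : I) : ∃ t', G.dartPath d t = G.edgePath d.1 t' := by
  rcases d with ⟨e, _ | _⟩
  · exact ⟨unitInterval.symm t, rfl⟩
  · exact ⟨t, rfl⟩

theorem collapseMap_edgePath {C : Set G.E} {e : G.E} (he : e ∉ C) (t : I) :
    G.collapseMap C (G.edgePath e t) =
      (G.collapse C).edgePath (⟨e, he⟩ : {e // e ∉ C}) t := by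
  classical
  exact congrArg (fun p : Path _ _ => p t) (dif_neg he)

theorem collapseMap_edgePath_of_mem {C : Set G.E} {e : G.E} (he : e ∈ C) (t : I) :
    G.collapseMap C (G.edgePath e t) = G.collapseMap C (G.vert (G.src e)) := by
  classical
  exact congrArg (fun p : Path _ _ => p t) (dif_pos he)

/-! ### Retractions onto the core -/

theorem IsLeafRetraction.vert {ρ : C(G.Realization, G.core.Realization)} (h : G.IsLeafRetraction ρ)
    {v : G.V} (hv : G.VInCore v) : ρ (G.vert v) = G.core.vert (toCoreV v hv) :=
  h.1 (G.core.vert (toCoreV v hv))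

theorem IsLeafRetraction.edgePath {ρ : C(G.Realization, G.core.Realization)}
    (h : G.IsLeafRetraction ρ) {e : G.E} (he : G.EInCore e) (t : I) :
    ρ (G.edgePath e t) = G.core.edgePath (toCoreE e he) t :=
  h.1 (G.core.edgePath (toCoreE e he) t)

theorem IsLeafRetraction.dartPath {ρ : C(G.Realization, G.core.Realization)}
    (h : G.IsLeafRetraction ρ) {d : G.Dart} (hd : ∃! d' : G.Dart, G.init d' = G.init d)
    (hv : G.VInCore (G.term d)) (t : I) :
    ρ (G.dartPath d t) = G.core.vert (toCoreV (G.term d) hv) := by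
  rw [← h.1 (ρ (G.dartPath d t)), h.2 d hd t, h.vert hv]

/-- The hypotheses say that outside the core there are only leaf edges and their tips, attached
directly to the core. Each such tip and edge is sent to the point of attachment. -/
theorem exists_isLeafRetraction
    (hV : ∀ v, ¬ G.VInCore v → ∃ d : G.Dart, G.init d = v ∧ (∃! d' : G.Dart, G.init d' = v) ∧
      G.VInCore (G.term d))
    (hE : ∀ e, ¬ G.EInCore e → ∃ d : G.Dart, d.1 = e ∧ (∃! d' : G.Dart, G.init d' = G.init d) ∧
      G.VInCore (G.term d)) :
    ∃ ρ : C(G.Realization, G.core.Realization), G.IsLeafRetraction ρ := by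
  have h1 (v : G.V) : ∃ y : G.core.V, (∀ h : G.VInCore v, y = toCoreV v h) ∧
      ∀ d : G.Dart, ∀ h : G.VInCore (G.term d), G.init d = v →
        (∃! d' : G.Dart, G.init d' = v) → y = toCoreV (G.term d) h := by
    by_cases hv : G.VInCore v
    · exact ⟨toCoreV v hv, fun _ => rfl,
        fun d h hd hu => absurd hv (not_vInCore_of_existsUnique hu)⟩
    · obtain ⟨d, hd, hu, ht⟩ := hV v hv
      refine ⟨toCoreV _ ht, fun h => absurd h hv, fun d' h' hd' _ => ?_⟩
      obtain rfl := hu.unique hd hd'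
      rfl
  choose ρV hρ1 hρ2 using h1
  have h2 (e : G.E) : ∃ p : Path (G.core.vert (ρV (G.src e))) (G.core.vert (ρV (G.tgt e))),
      (∀ (h : G.EInCore e) (t : I), p t = G.core.edgePath (toCoreE e h) t) ∧
      (¬ G.EInCore e → ∀ t, p t = G.core.vert (ρV (G.src e))) := by
    by_cases he : G.EInCore e
    · exact ⟨(G.core.edgePath (toCoreE e he)).cast (by rw [hρ1 _ he.ends.1]; rfl)
        (by rw [hρ1 _ he.ends.2]; rfl), fun _ _ => rfl, fun h => absurd he h⟩
    · obtain ⟨d, rfl, hu, ht⟩ := hE e he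
      have h3 : ρV (G.init d) = ρV (G.term d) := by rw [hρ2 _ d ht rfl hu, hρ1 _ ht]
      have h4 : ρV (G.src d.1) = ρV (G.tgt d.1) := by
        rcases d with ⟨e, _ | _⟩
        exacts [h3.symm, h3]
      exact ⟨(Path.refl _).cast rfl (by rw [h4]), fun h => absurd h he, fun _ _ => rfl⟩
  choose p hp1 hp2 using h2
  refine ⟨G.lift (fun v => G.core.vert (ρV v)) p, fun x => ?_, fun d hu t => ?_⟩
  · rcases realization_cases x with ⟨v, rfl⟩ | ⟨e, t, rfl⟩
    · rw [Hom.real_vert, lift_vert, hρ1 _ (vInCore_onV v)]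
      rfl
    · rw [Hom.real_edgePath, lift_edgePath, hp1 _ (eInCore_onE e)]
      rfl
  · have hd := not_eInCore_of_existsUnique hu
    -- The dart supplied by `hE` could be the reverse of `d`, but then the tip of the leaf would lie
    -- in the core.
    have ht : G.VInCore (G.term d) := by
      obtain ⟨d', h3, h4, h5⟩ := hE _ hd
      rcases dart_eq_or_eq_rev h3 with rfl | rfl
      · exact h5
      · rw [term_rev] at h5
        exact absurd h5 (not_vInCore_of_existsUnique hu)
    have h3 : ρV (G.init d) = ρV (G.term d) := by rw [hρ2 _ d ht rfl hu, hρ1 _ ht]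
    have h4 : ρV (G.src d.1) = ρV (G.term d) := by
      rcases d with ⟨e, _ | _⟩
      exacts [rfl, h3]
    obtain ⟨t', ht'⟩ := exists_edgePath_eq d t
    rw [ht', lift_edgePath, hp2 _ hd, h4, hρ1 _ ht]
    rfl

/-! ### Monotone reparametrizations -/

theorem _root_.Path.trans_monotone {X : Type*} [TopologicalSpace X] [Preorder X] {a b c : X}
    {p : Path a b} {q : Path b c} (hp : Monotone p) (hq : Monotone q) : Monotone (p.trans q) := by
  intro t t' h
  have h' : (t : ℝ) ≤ t' := h
  rw [Path.trans_apply, Path.trans_apply]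
  split_ifs with h1 h2 h2
  · exact hp (Subtype.mk_le_mk.2 (by linarith))
  · calc p _ ≤ p 1 := hp unitInterval.le_one'
      _ = q 0 := by rw [p.target, q.source]
      _ ≤ _ := hq unitInterval.nonneg'
  · linarith
  · exact hq (Subtype.mk_le_mk.2 (by linarith))

theorem IsMonotoneReparam.refl {Y : Type} (δ : I → Y) : IsMonotoneReparam δ δ :=
  ⟨id, continuous_id, monotone_id, rfl, rfl, fun _ => rfl⟩

theorem IsMonotoneReparam.comp {Y Z : Type} {γ δ : I → Y} (h : IsMonotoneReparam γ δ)
    (f : Y → Z) : IsMonotoneReparam (fun t => f (γ t)) (fun t => f (δ t)) := by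
  obtain ⟨s, h1, h2, h3, h4, h5⟩ := h
  exact ⟨s, h1, h2, h3, h4, fun t => congrArg f (h5 t)⟩

/-- The time change waits at `0` along `p` and then follows that of `q`. -/
theorem IsMonotoneReparam.const_trans {X Y : Type} [TopologicalSpace X] {x y z : X}
    {p : Path x y} {q : Path y z} {g : X → Y} {δ : I → Y} (hp : ∀ t, g (p t) = δ 0)
    (hq : IsMonotoneReparam (fun t => g (q t)) δ) :
    IsMonotoneReparam (fun t => g (p.trans q t)) δ := by
  obtain ⟨s, h1, h2, h3, h4, h5⟩ := hq
  let s' : Path (0 : I) 1 := ⟨⟨s, h1⟩, h3, h4⟩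
  refine ⟨(Path.refl 0).trans s', Path.continuous _,
    Path.trans_monotone (fun _ _ _ => le_rfl) h2, Path.source _, Path.target _, fun t => ?_⟩
  beta_reduce
  rw [Path.trans_apply, Path.trans_apply]
  split_ifs
  · exact hp _
  · exact h5 _

theorem IsMonotoneReparam.trans_const {X Y : Type} [TopologicalSpace X] {x y z : X}
    {p : Path x y} {q : Path y z} {g : X → Y} {δ : I → Y}
    (hp : IsMonotoneReparam (fun t => g (p t)) δ) (hq : ∀ t, g (q t) = δ 1) :
    IsMonotoneReparam (fun t => g (p.trans q t)) δ := by
  obtain ⟨s, h1, h2, h3, h4, h5⟩ := hp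
  let s' : Path (0 : I) 1 := ⟨⟨s, h1⟩, h3, h4⟩
  refine ⟨s'.trans (Path.refl 1), Path.continuous _,
    Path.trans_monotone h2 (fun _ _ _ => le_rfl), Path.source _, Path.target _, fun t => ?_⟩
  beta_reduce
  rw [Path.trans_apply, Path.trans_apply]
  split_ifs
  · exact h5 _
  · exact hq _

/-- The convex combination `(1 - u) s + u t` in the unit interval. -/
def convexComb (u s t : I) : I :=
  ⟨(1 - u) * s + u * t, by
    have := u.2.1; have := u.2.2; have := s.2.1; have := s.2.2; have := t.2.1; have := t.2.2
    constructor
    · have : 0 ≤ 1 - (u : ℝ) := by linarith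
      positivity
    · nlinarith⟩

theorem continuous_convexComb : Continuous fun x : I × I × I => convexComb x.1 x.2.1 x.2.2 := by
  unfold convexComb
  fun_prop

@[simp] theorem convexComb_zero (s t : I) : convexComb 0 s t = s := by ext; simp [convexComb]

@[simp] theorem convexComb_one (s t : I) : convexComb 1 s t = t := by ext; simp [convexComb]

@[simp] theorem convexComb_self (u s : I) : convexComb u s s = s := by
  ext; simp only [convexComb]; ring

/-- Maps which agree on the vertices and agree on each edge up to a monotone reparametrization are
homotopic relative to the vertices. -/
theorem homotopicRel_of_isMonotoneReparam {Y : Type} [TopologicalSpace Y]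
    {f g : C(G.Realization, Y)} (hV : ∀ v, f (G.vert v) = g (G.vert v))
    (hE : ∀ e, IsMonotoneReparam (fun t => f (G.edgePath e t)) (fun t => g (G.edgePath e t))) :
    f.HomotopicRel g (Set.range G.vert) := by
  choose s hs _ hs0 hs1 hfs using hE
  have hc (e : G.E) : Continuous fun x : I × I =>
      g (G.edgePath e (convexComb x.2 (s e x.1) x.1)) := by
    refine g.continuous.comp ((G.edgePath e).continuous.comp ?_)
    exact continuous_convexComb.comp
      (continuous_snd.prodMk (((hs e).comp continuous_fst).prodMk continuous_fst))
  -- At time `u` the edge is run through with time change `(1 - u) s + u t`. Regarding the homotopy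
  -- as a map into `C(I, Y)` lets `lift` provide continuity on the quotient space; uncurrying then
  -- returns a homotopy.
  let K : C(G.Realization, C(I, Y)) := G.lift (fun v => ContinuousMap.const I (g (G.vert v)))
    fun e =>
      { toContinuousMap := ContinuousMap.curry ⟨_, hc e⟩
        source' := by
          ext u
          change g (G.edgePath e (convexComb u (s e 0) 0)) = g (G.vert (G.src e))
          rw [hs0, convexComb_self, Path.source]
        target' := by
          ext u
          change g (G.edgePath e (convexComb u (s e 1) 1)) = g (G.vert (G.tgt e))
          rw [hs1, convexComb_self, Path.target] }
  refine ⟨⟨⟨⟨fun x => K x.2 x.1, ?_⟩, fun x => ?_, fun x => ?_⟩, ?_⟩⟩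
  · exact (ContinuousMap.uncurry K).continuous.comp continuous_swap
  · rcases realization_cases x with ⟨v, rfl⟩ | ⟨e, t, rfl⟩
    · exact (hV v).symm
    · change g (G.edgePath e (convexComb 0 (s e t) t)) = _
      rw [convexComb_zero]
      exact (hfs e t).symm
  · rcases realization_cases x with ⟨v, rfl⟩ | ⟨e, t, rfl⟩
    · rfl
    · change g (G.edgePath e (convexComb 1 (s e t) t)) = _
      rw [convexComb_one]
  · rintro u _ ⟨v, rfl⟩
    exact (hV v).symm

end LGraph

namespace WhiteheadAut

open LGraph

variable {n : ℕ} {φ : WhiteheadAut n} {H : Subgroup (FreeGroup (Fin n))}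
  {F : LGraph n} {r : Hom (φ.subd (coreOf H)) F}

/-! ### Comparison of the two maps -/

/-- The vertices of `F` outside the core are old vertices outside case (i), and the edges outside
the core are new ones. -/
theorem exists_leafRetraction (hH : H.FG) (hr : IsMaximalFolding r) (hφ : φ.Trichotomy H) :
    ∃ ρ : C(F.Realization, F.core.Realization), F.IsLeafRetraction ρ := by
  have hterm (d : φ.ActedDart (coreOf H)) : F.VInCore (F.term (r.onD (φ.newD _ d))) := by
    rw [term_newD_eq hH hr]
    exact vInCore_retractV hH hr hφ _
  refine exists_isLeafRetraction (fun y hy => ?_) (fun x hx => ?_)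
  · obtain ⟨x, rfl⟩ := hr.1.surjective.1 y
    rcases φ.subd_vertex_cases x with ⟨v, rfl⟩ | ⟨d, rfl⟩
    · by_cases hv : φ.CaseI (coreOf H) v
      · rw [← retractV_of_caseI hv] at hy
        exact absurd (vInCore_retractV hH hr hφ v) hy
      · obtain ⟨d, rfl⟩ := exists_actedDart hv
        have h := existsUnique_newD hH hr hφ d
        have h' : F.init (r.onD (φ.newD _ d)) = r.onV (φ.oldV _ ((coreOf H).init d.1)) := by simp
        exact ⟨r.onD (φ.newD _ d), h', h' ▸ h, hterm d⟩
    · rw [← retractV_actedDart hH hr] at hy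
      exact absurd (vInCore_retractV hH hr hφ _) hy
  · rcases edge_cases hH hr hφ x with ⟨e, he, rfl⟩ | ⟨d, rfl⟩
    · exact absurd (eInCore_midE hH hr hφ he) hx
    · exact ⟨_, rfl, existsUnique_newD hH hr hφ d, hterm d⟩

/-- The vertex of the core of the folded graph to which a vertex of the core graph is sent. -/
def coreV (hH : H.FG) (hr : IsMaximalFolding r) (hφ : φ.Trichotomy H) (v : (coreOf H).V) :
    F.core.V := toCoreV (retractV r v) (vInCore_retractV hH hr hφ v)

/-- The edge of the core of the folded graph to which a non-collapsed edge is sent. -/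
def coreE (hH : H.FG) (hr : IsMaximalFolding r) (hφ : φ.Trichotomy H) (e : (coreOf H).E)
    (he : e ∉ φ.collapsed (coreOf H)) : F.core.E := toCoreE (midE r e) (eInCore_midE hH hr hφ he)

theorem src_coreE (hH : H.FG) (hr : IsMaximalFolding r) (hφ : φ.Trichotomy H) (e : (coreOf H).E)
    (he : e ∉ φ.collapsed (coreOf H)) :
    F.core.src (coreE hH hr hφ e he) = coreV hH hr hφ ((coreOf H).src e) :=
  (quotientIso hH hr hφ).src_onE ⟨e, he⟩

theorem tgt_coreE (hH : H.FG) (hr : IsMaximalFolding r) (hφ : φ.Trichotomy H) (e : (coreOf H).E)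
    (he : e ∉ φ.collapsed (coreOf H)) :
    F.core.tgt (coreE hH hr hφ e he) = coreV hH hr hφ ((coreOf H).tgt e) :=
  (quotientIso hH hr hφ).tgt_onE ⟨e, he⟩

theorem quotientIso_vert (hH : H.FG) (hr : IsMaximalFolding r) (hφ : φ.Trichotomy H)
    (v : (coreOf H).V) : (quotientIso hH hr hφ).toHom.real (φ.quotientMap H ((coreOf H).vert v)) =
      F.core.vert (coreV hH hr hφ v) := rfl

theorem quotientIso_edgePath (hH : H.FG) (hr : IsMaximalFolding r) (hφ : φ.Trichotomy H)
    {e : (coreOf H).E} (he : e ∉ φ.collapsed (coreOf H)) (t : I) :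
    (quotientIso hH hr hφ).toHom.real (φ.quotientMap H ((coreOf H).edgePath e t)) =
      F.core.edgePath (coreE hH hr hφ e he) t :=
  congrArg (quotientIso hH hr hφ).toHom.real (collapseMap_edgePath he t)

theorem quotientIso_edgePath_of_mem (hH : H.FG) (hr : IsMaximalFolding r) (hφ : φ.Trichotomy H)
    {e : (coreOf H).E} (he : e ∈ φ.collapsed (coreOf H)) (t : I) :
    (quotientIso hH hr hφ).toHom.real (φ.quotientMap H ((coreOf H).edgePath e t)) =
      F.core.vert (coreV hH hr hφ ((coreOf H).src e)) :=
  congrArg (quotientIso hH hr hφ).toHom.real (collapseMap_edgePath_of_mem he t)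

variable {ρ : C(F.Realization, F.core.Realization)}

theorem retraction_newPath (hH : H.FG) (hr : IsMaximalFolding r) (hφ : φ.Trichotomy H)
    (hρ : F.IsLeafRetraction ρ) (d : φ.ActedDart (coreOf H)) (t : I) :
    ρ (r.real (φ.newPath (coreOf H) d t)) =
      F.core.vert (coreV hH hr hφ ((coreOf H).init d.1)) := by
  have h1 : φ.newPath (coreOf H) d t = (φ.subd (coreOf H)).dartPath (φ.newD _ d) t := rfl
  have h2 := term_newD_eq hH hr d
  rw [h1, Hom.real_dartPath, hρ.dartPath (existsUnique_newD hH hr hφ d)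
    (by rw [h2]; exact vInCore_retractV hH hr hφ _)]
  exact congrArg F.core.vert (coreIncl_onV_injective h2)

theorem retraction_vert (hH : H.FG) (hr : IsMaximalFolding r) (hφ : φ.Trichotomy H)
    (hρ : F.IsLeafRetraction ρ) (v : (coreOf H).V) :
    ρ (r.real (φ.subdMap (coreOf H) ((coreOf H).vert v))) = F.core.vert (coreV hH hr hφ v) := by
  by_cases hv : φ.CaseI (coreOf H) v
  · have h1 : r.real (φ.subdMap (coreOf H) ((coreOf H).vert v)) = F.vert (retractV r v) := by
      rw [retractV_of_caseI hv]; rfl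
    rw [h1, hρ.vert (vInCore_retractV hH hr hφ v)]
    rfl
  · obtain ⟨d, rfl⟩ := exists_actedDart hv
    rw [← retraction_newPath hH hr hφ hρ d 0, Path.source]
    rfl

theorem retraction_mid (hH : H.FG) (hr : IsMaximalFolding r) (hφ : φ.Trichotomy H)
    (hρ : F.IsLeafRetraction ρ) {e : (coreOf H).E} (he : e ∉ φ.collapsed (coreOf H)) (t : I) :
    ρ (r.real ((φ.subd (coreOf H)).edgePath (Sum.inl e) t)) =
      F.core.edgePath (coreE hH hr hφ e he) t :=
  hρ.edgePath (eInCore_midE hH hr hφ he) t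

/-- A collapsed edge has been folded onto a leaf edge, which the retraction contracts. -/
theorem retraction_mid_of_mem (hH : H.FG) (hr : IsMaximalFolding r) (hφ : φ.Trichotomy H)
    (hρ : F.IsLeafRetraction ρ) {e : (coreOf H).E} (he : e ∈ φ.collapsed (coreOf H)) (t : I) :
    ρ (r.real ((φ.subd (coreOf H)).edgePath (Sum.inl e) t)) =
      F.core.vert (coreV hH hr hφ ((coreOf H).src e)) := by
  obtain ⟨d, rfl, h1, h2⟩ := he
  obtain ⟨d', h3, h4⟩ := oldD_eq_newD hH hr hφ h1 h2
  have h5 : coreV hH hr hφ ((coreOf H).src d.1) = coreV hH hr hφ ((coreOf H).init d) := by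
    have h6 := retractV_collapsed hH hr hφ (d := d) ⟨d, rfl, h1, h2⟩
    refine coreIncl_onV_injective ?_
    rcases d with ⟨e, _ | _⟩
    exacts [h6.symm, rfl]
  -- When `a` is the inverse of a generator the dart runs against its edge, and the parameter is
  -- reversed.
  obtain ⟨t', ht'⟩ := exists_dartPath_eq (G := F) (r.onD (φ.oldD _ d)) t
  have h6 : r.real ((φ.subd (coreOf H)).edgePath (Sum.inl d.1) t) =
      r.real (φ.newPath (coreOf H) d' t') := by
    refine Eq.trans ht' ?_
    rw [h4, ← Hom.real_dartPath]
    rfl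
  rw [h6, retraction_newPath hH hr hφ hρ, h3, h5]

/-- The new pieces at the ends lie on leaf edges and become constant; only the middle part moves,
with its own parameter. A collapsed edge is not subdivided, and both maps are constant on it. -/
theorem isMonotoneReparam_edge (hH : H.FG) (hr : IsMaximalFolding r) (hφ : φ.Trichotomy H)
    (hρ : F.IsLeafRetraction ρ) (e : (coreOf H).E) :
    IsMonotoneReparam (fun t => ρ (r.real (φ.subdMap (coreOf H) ((coreOf H).edgePath e t))))
      (fun t => (quotientIso hH hr hφ).toHom.real
        (φ.quotientMap H ((coreOf H).edgePath e t))) := by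
  change IsMonotoneReparam (fun t => ρ (r.real (φ.subdPath (coreOf H) e t))) _
  by_cases he : e ∈ φ.collapsed (coreOf H)
  · have h1 : (coreOf H).letter (e, true) ∉ φ.A := fun h => notMem_collapsed_of_mem h he
    have h2 : (coreOf H).letter (e, false) ∉ φ.A := fun h => notMem_collapsed_of_mem h he
    simp only [quotientIso_edgePath_of_mem hH hr hφ he]
    rw [subdPath, dif_neg h1, dif_neg h2]
    simp only [Path.cast_coe, retraction_mid_of_mem hH hr hφ hρ he]
    exact IsMonotoneReparam.refl _
  · simp only [quotientIso_edgePath hH hr hφ he]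
    have hm : IsMonotoneReparam
        (fun t => ρ (r.real ((φ.subd (coreOf H)).edgePath (Sum.inl e) t)))
        (fun t => F.core.edgePath (coreE hH hr hφ e he) t) := by
      simp only [retraction_mid hH hr hφ hρ he]
      exact IsMonotoneReparam.refl _
    have h0 (h : (coreOf H).letter (e, true) ∈ φ.A) (t : I) :
        ρ (r.real (φ.newPath (coreOf H) ⟨(e, true), h⟩ t)) =
          F.core.edgePath (coreE hH hr hφ e he) 0 := by
      rw [retraction_newPath hH hr hφ hρ, Path.source, src_coreE]
      rfl
    have h1 (h : (coreOf H).letter (e, false) ∈ φ.A) (t : I) :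
        ρ (r.real (φ.newPath (coreOf H) ⟨(e, false), h⟩ t)) =
          F.core.edgePath (coreE hH hr hφ e he) 1 := by
      rw [retraction_newPath hH hr hφ hρ, Path.target, tgt_coreE]
      rfl
    by_cases ha : (coreOf H).letter (e, true) ∈ φ.A <;>
      by_cases hb : (coreOf H).letter (e, false) ∈ φ.A
    · rw [show φ.subdPath (coreOf H) e = _ from (dif_pos ha).trans (dif_pos hb)]
      refine IsMonotoneReparam.trans_const (g := fun x => ρ (r.real x))
        (IsMonotoneReparam.const_trans (g := fun x => ρ (r.real x)) ?_ ?_) ?_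
      exacts [h0 ha, hm, fun t => h1 hb _]
    · rw [show φ.subdPath (coreOf H) e = _ from (dif_pos ha).trans (dif_neg hb)]
      refine IsMonotoneReparam.const_trans (g := fun x => ρ (r.real x)) ?_ ?_
      exacts [h0 ha, hm]
    · rw [show φ.subdPath (coreOf H) e = _ from (dif_neg ha).trans (dif_pos hb)]
      refine IsMonotoneReparam.trans_const (g := fun x => ρ (r.real x)) ?_ ?_
      exacts [hm, fun t => h1 hb _]
    · rw [show φ.subdPath (coreOf H) e = _ from (dif_neg ha).trans (dif_neg hb)]
      exact hm

end WhiteheadAut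

/-- Composition of isomorphisms of labelled graphs. -/
def LGraph.Iso.trans {n : ℕ} {G G' G'' : LGraph n} (f : LGraph.Iso G G') (g : LGraph.Iso G' G'') :
    LGraph.Iso G G'' where
  toHom := g.toHom.comp f.toHom
  bijective_onV := g.bijective_onV.comp f.bijective_onV
  bijective_onE := g.bijective_onE.comp f.bijective_onE

theorem LGraph.Hom.real_comp {n : ℕ} {G G' G'' : LGraph n} (g : LGraph.Hom G' G'')
    (f : LGraph.Hom G G') (x : G.Realization) : (g.comp f).real x = g.real (f.real x) := by
  rcases LGraph.realization_cases x with ⟨v, rfl⟩ | ⟨e, t, rfl⟩ <;> rfl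

end

theorem mainTheorem4 {n : ℕ} (φ : WhiteheadAut n) (H : Subgroup (FreeGroup (Fin n)))
    (hH : H ≠ ⊥) (hfg : H.FG) (hφ : φ.Trichotomy H) :
    -- the quotient of the core graph of `H` is isomorphic to the core graph of `φ(H)`
    Nonempty (LGraph.Iso (φ.quotientGraph H) (LGraph.coreOf (φ.image H))) ∧
    -- the subdivided core graph has a folded graph
    (∃ (F : LGraph n) (r₂ : LGraph.Hom (φ.subd (LGraph.coreOf H)) F),
      LGraph.IsMaximalFolding r₂) ∧
    -- for each maximal sequence of foldings, with final graph `F`: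
    ∀ (F : LGraph n) (r₂ : LGraph.Hom (φ.subd (LGraph.coreOf H)) F), LGraph.IsMaximalFolding r₂ →
      -- the retraction of `F` onto its core exists, and this core is the core graph of `φ(H)`
      (∃ r₃ : C(F.Realization, F.core.Realization), F.IsLeafRetraction r₃) ∧
      Nonempty (LGraph.Iso F.core (LGraph.coreOf (φ.image H))) ∧
      -- and whichever way the core of `F` is identified with the core graph of `φ(H)`,
      ∀ (r₃ : C(F.Realization, F.core.Realization)), F.IsLeafRetraction r₃ →
        ∀ ι : LGraph.Iso F.core (LGraph.coreOf (φ.image H)),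
          ∃ θ : LGraph.Iso (φ.quotientGraph H) (LGraph.coreOf (φ.image H)),
            let r : C((LGraph.coreOf H).Realization, (LGraph.coreOf (φ.image H)).Realization) :=
              ι.toHom.real.comp (r₃.comp (r₂.real.comp (φ.subdMap (LGraph.coreOf H))))
            let θq : C((LGraph.coreOf H).Realization, (LGraph.coreOf (φ.image H)).Realization) :=
              θ.toHom.real.comp (φ.quotientMap H)
            (∀ v, r ((LGraph.coreOf H).vert v) = θq ((LGraph.coreOf H).vert v)) ∧
            (∀ e, LGraph.IsMonotoneReparam
              (fun t => r ((LGraph.coreOf H).edgePath e t))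
              (fun t => θq ((LGraph.coreOf H).edgePath e t))) ∧
            r.HomotopicRel θq (Set.range (LGraph.coreOf H).vert) := by
  obtain ⟨F₀, r₀, hr₀⟩ := φ.exists_maximalFolding hfg
  obtain ⟨ι₀⟩ := φ.nonempty_core_iso hfg hH hr₀
  -- For part 1 any one maximal folding serves. Afterwards `θ` is built from the given folding and
  -- `ι`, and works for every `r₃`.
  refine ⟨⟨(WhiteheadAut.quotientIso hfg hr₀ hφ).trans ι₀⟩, ⟨F₀, r₀, hr₀⟩, fun F r₂ hr =>
    ⟨WhiteheadAut.exists_leafRetraction hfg hr hφ, φ.nonempty_core_iso hfg hH hr,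
      fun r₃ hr₃ ι => ⟨(WhiteheadAut.quotientIso hfg hr hφ).trans ι, ?_⟩⟩⟩
  intro r θq
  have hθ (x : (LGraph.coreOf H).Realization) : θq x =
      ι.toHom.real ((WhiteheadAut.quotientIso hfg hr hφ).toHom.real (φ.quotientMap H x)) :=
    LGraph.Hom.real_comp _ _ _
  have hV (v : (LGraph.coreOf H).V) :
      r ((LGraph.coreOf H).vert v) = θq ((LGraph.coreOf H).vert v) := by
    rw [hθ, WhiteheadAut.quotientIso_vert]
    exact congrArg ι.toHom.real (WhiteheadAut.retraction_vert hfg hr hφ hr₃ v)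
  have hE (e : (LGraph.coreOf H).E) : LGraph.IsMonotoneReparam
      (fun t => r ((LGraph.coreOf H).edgePath e t))
      (fun t => θq ((LGraph.coreOf H).edgePath e t)) := by
    simp only [hθ]
    exact (WhiteheadAut.isMonotoneReparam_edge hfg hr hφ hr₃ e).comp ι.toHom.real
  exact ⟨hV, hE, LGraph.homotopicRel_of_isMonotoneReparam hV hE⟩
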